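/- **Setting.** Let $p\ge 1$, $0<b<1$, $c>0$. Let $\rho:\mathbb R\to\mathbb R$ be even, nondecreasing on $[0,\infty)$, with $\rho(0)=0$, $\lim_{u\to\infty}\rho(u)=1$ and only finitely many discontinuities; put $\rho(\infty)=1$. Let $H_o=F_o\otimes G_o$ be the law of $(y,\mathbf x)\in\mathbb R\times\mathbb R^p$, where $F_o$ has a Lebesgue density that is symmetric, continuous and strictly decreasing on $(0,\infty)$, and $P_{G_o}(\mathbf x'\boldsymbol\theta=a)<1$ for all $\boldsymbol\theta\ne\mathbf 0$, $a\in\mathbb R$ (so the true parameters are normalized to $\mathbf 0$). **CM-estimates.** For a probability law $H$ on $\mathbb R\times\mathbb R^p$ a CM-solution minimizes $$L_H(\alpha,\boldsymbol\theta,\sigma)=c\,E_H\Big[\rho\Big(\frac{y-\alpha-\mathbf x'\boldsymbol\theta}{\sigma}\Big)\Big]+\log\sigma\quad\text{subject to}\quad \sigma>0,\quad E_H\Big[\rho\Big(\frac{y-\alpha-\mathbf x'\boldsymbol\theta}{\sigma}\Big)\Big]\le b ,$$ in the sense that $(\alpha,\boldsymbol\theta)$ minimizes $\inf_\sigma L_H(\alpha,\boldsymbol\theta,\sigma)$,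 the infimum being over admissible $\sigma$, and the minimal value is finite. A CM-estimate $\mathbf T_{CM}$ of the slopes assigns to each $H$ the slope part $\boldsymbol\theta$ of some CM-solution at $H$, and is undefined exactly when there is none; put $b(\mathbf T_{CM},H)=\|\mathbf T_{CM}(H)\|$ where it is defined and $b(\mathbf T_{CM},H)=\infty$ otherwise. For $0\le\varepsilon\le1$ the maximum bias is $$B_{CM}(\varepsilon)=\sup\{\,b(\mathbf T_{CM},(1-\varepsilon)H_o+\varepsilon H^*) : H^* \text{ a probability law on } \mathbb R^{p+1}\}\in[0,\infty].$$ **The functional $J_{CM}$.** For a probability law $F$ on $[0,\infty]$ let $\sigma(F)=\inf\{s>0: E_F[\rho(y/s)]\le b\}\in[0,\infty]$ (the M-scale; it is the solution of $E_F[\rho(y/\sigma)]=b$ when there is exactly one) and $$J_{CM}(F)=\inf_{0<s<\infty,\ s\ge\sigma(F)}\big\{c\,E_F[\rho(y/s)]+\log s\big\}\in[-\infty,\infty].$$ Let $F_{H,\alpha,\boldsymbol\theta}$ be the law of $|y-\alpha-\mathbf x'\boldsymbol\theta|$ under $H$, and let $$r_{CM}(\varepsilon)=J_{CM}[(1-\varepsilon)F_{H_o,0,\mathbf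 0}+\varepsilon\delta_\infty],\qquad m_{CM}(t)=\inf_{\|\boldsymbol\theta\|=t}\ \inf_{\alpha\in\mathbb R}J_{CM}[(1-\varepsilon)F_{H_o,\alpha,\boldsymbol\theta}+\varepsilon\delta_0]\quad(t\ge0).$$ **Theorem 3.2.** For every CM-estimate $\mathbf T_{CM}$ and every $\varepsilon\in[0,1]$, $$B_{CM}(\varepsilon)=m_{CM}^{-1}[r_{CM}(\varepsilon)],\qquad\text{where } m_{CM}^{-1}(r)=\sup\{t\ge0: m_{CM}(t)\le r\}\in[0,\infty].$$ Moreover, if $\varepsilon<1-b$ and $r_{CM}(\varepsilon)<\infty$, then $m_{CM}$ is strictly increasing on $[0,\infty)$, and for every real $t\ge0$, $B_{CM}(\varepsilon)=t$ if and only if $m_{CM}(t)=r_{CM}(\varepsilon)$. If $\rho$ is continuous at $0$ and $\varepsilon<b$, then $r_{CM}(\varepsilon)<\infty$. -/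

import Mathlib

open MeasureTheory Filter Topology

noncomputable section

namespace CMRegression

/-- The space of regressors `ℝ^p` with the Euclidean norm. -/
abbrev Regr (p : ℕ) : Type := EuclideanSpace ℝ (Fin p)

/-- The conditions on the loss function: even, nondecreasing on `[0, ∞)`, vanishing at `0`, with
limit `1` at infinity (hence with values in `[0, 1]`), and finitely many discontinuities. -/
structure IsLoss (ρ : ℝ → ℝ) : Prop where
  even : ∀ u, ρ (-u) = ρ u
  mono : MonotoneOn ρ (Set.Ici 0)
  map_zero : ρ 0 = 0
  tendsto_one : Tendsto ρ atTop (𝓝 1)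
  finite_discont : {u : ℝ | ¬ ContinuousAt ρ u}.Finite

/-- The error law has a Lebesgue density that is symmetric, continuous and strictly decreasing on
the positive half line. -/
def IsErrorLaw (F : Measure ℝ) : Prop :=
  ∃ f : ℝ → ℝ, (∀ u, 0 ≤ f u) ∧ (∀ u, f (-u) = f u) ∧ Continuous f ∧
    StrictAntiOn f (Set.Ioi 0) ∧ F = volume.withDensity (fun u => ENNReal.ofReal (f u))

/-- The regressor law puts full mass on no hyperplane. -/
def IsRegressorLaw {p : ℕ} (G : Measure (Regr p)) : Prop :=
  ∀ θ : Regr p, θ ≠ 0 → ∀ a : ℝ, G {x | inner ℝ x θ = a} < 1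

/-- The mixture `(1 - ε) μ + ε ν`. -/
def mix {X : Type*} [MeasurableSpace X] (ε : ℝ) (μ ν : Measure X) : Measure X :=
  ENNReal.ofReal (1 - ε) • μ + ENNReal.ofReal ε • ν

/-! ### The constrained M-estimate -/

/-- `E_H ρ((y - α - x'θ) / σ)` for a law `H` of `(y, x)`. -/
def meanLoss {p : ℕ} (ρ : ℝ → ℝ) (H : Measure (ℝ × Regr p)) (α : ℝ) (θ : Regr p) (σ : ℝ) : ℝ :=
  ∫ z, ρ ((z.1 - α - inner ℝ z.2 θ) / σ) ∂H

/-- The CM objective `L_H(α, θ, σ) = c E_H ρ((y - α - x'θ) / σ) + log σ`. -/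
def cmObjective {p : ℕ} (ρ : ℝ → ℝ) (c : ℝ) (H : Measure (ℝ × Regr p))
    (α : ℝ) (θ : Regr p) (σ : ℝ) : ℝ :=
  c * meanLoss ρ H α θ σ + Real.log σ

/-- The infimum of the CM objective at `(α, θ)` over the scales `σ > 0` that satisfy the
constraint `E_H ρ((y - α - x'θ) / σ) ≤ b` (it is `⊤` if there is no such scale). -/
def cmProfile {p : ℕ} (ρ : ℝ → ℝ) (c b : ℝ) (H : Measure (ℝ × Regr p))
    (α : ℝ) (θ : Regr p) : EReal :=
  ⨅ (σ : ℝ) (_ : 0 < σ) (_ : meanLoss ρ H α θ σ ≤ b), (cmObjective ρ c H α θ σ : EReal)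

/-- `θ` is the slope part of a solution of the constrained minimization problem at `H`: for some
intercept `α`, the infimum of the objective over all admissible `(α', θ', σ)` is finite and is
already the infimum over the admissible `(α, θ, σ)`. If `ρ` is left-continuous on `[0, ∞)`
the infimum over `σ` is attained, and `(α, θ)` completes to a minimizing triple
`(α, θ, σ)`; for other `ρ` minimizing triples need not exist. -/
def IsCMSlope {p : ℕ} (ρ : ℝ → ℝ) (c b : ℝ) (H : Measure (ℝ × Regr p)) (θ : Regr p) : Prop :=
  ∃ α v : ℝ, cmProfile ρ c b H α θ = v ∧
    ∀ (α' : ℝ) (θ' : Regr p), cmProfile ρ c b H α θ ≤ cmProfile ρ c b H α' θ'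

/-- `T` is a CM-estimate of the slopes: `T H` is (any choice of) a solution at `H`, and is
undefined (`none`) exactly when there is no solution at `H`. -/
def IsCMEstimate {p : ℕ} (ρ : ℝ → ℝ) (c b : ℝ)
    (T : ProbabilityMeasure (ℝ × Regr p) → Option (Regr p)) : Prop :=
  ∀ H : ProbabilityMeasure (ℝ × Regr p),
    (∀ θ, T H = some θ → IsCMSlope ρ c b (H : Measure (ℝ × Regr p)) θ) ∧
    (T H = none → ∀ θ, ¬ IsCMSlope ρ c b (H : Measure (ℝ × Regr p)) θ)

/-! ### Maximum bias -/

/-- The asymptotic bias at a law where the estimate is `τ`; it is infinite where the estimate is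
undefined. -/
def bias {p : ℕ} : Option (Regr p) → ENNReal
  | none => ⊤
  | some θ => ENNReal.ofReal ‖θ‖

/-- The `ε`-contamination neighbourhood of `H`. -/
def neighborhood {p : ℕ} (H : Measure (ℝ × Regr p)) (ε : ℝ) :
    Set (ProbabilityMeasure (ℝ × Regr p)) :=
  {K | ∃ K' : ProbabilityMeasure (ℝ × Regr p),
    (K : Measure (ℝ × Regr p)) = mix ε H (K' : Measure (ℝ × Regr p))}

/-- The maximum asymptotic bias of `T` over the `ε`-contamination neighbourhood of `H`. -/
def maxBias {p : ℕ} (T : ProbabilityMeasure (ℝ × Regr p) → Option (Regr p))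
    (H : Measure (ℝ × Regr p)) (ε : ℝ) : ENNReal :=
  ⨆ K ∈ neighborhood H ε, bias (T K)

/-! ### The functional `J` on laws on `[0, ∞]` -/

/-- The law `F_{H,α,θ}` of the absolute residual `|y - α - x'θ|`, as a measure on `[0, ∞]`. -/
def absResidLaw {p : ℕ} (H : Measure (ℝ × Regr p)) (α : ℝ) (θ : Regr p) : Measure ENNReal :=
  H.map (fun z => ENNReal.ofReal |z.1 - α - inner ℝ z.2 θ|)

/-- The extension of `ρ` to `[0, ∞]` by its limit `ρ(∞) = 1`. -/
def lossExt (ρ : ℝ → ℝ) (v : ENNReal) : ℝ := if v = ⊤ then 1 else ρ v.toReal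

/-- `E_F ρ(y / s)` for a law `F` on `[0, ∞]` and `s > 0`. -/
def meanLossExt (ρ : ℝ → ℝ) (F : Measure ENNReal) (s : ℝ) : ℝ :=
  ∫ v, lossExt ρ (v / ENNReal.ofReal s) ∂F

/-- The M-scale of `F`: the solution `σ` of `E_F ρ(y / σ) = b` if it is unique, and the infimum of
the solutions if there are several. In general, since `E_F ρ(y / s)` is nonincreasing in `s`, it is the point where it crosses the level
`b`; it is `0` if it is below `b` for all `s`, and `∞` if it is always above `b`. -/
def mScale (ρ : ℝ → ℝ) (b : ℝ) (F : Measure ENNReal) : ENNReal :=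
  ⨅ (s : ℝ) (_ : 0 < s) (_ : meanLossExt ρ F s ≤ b), ENNReal.ofReal s

/-- `J(F) = inf_{s ≥ σ(F)} c E_F ρ(y / s) + log s` (over finite `s > 0`). -/
def cmJ (ρ : ℝ → ℝ) (c b : ℝ) (F : Measure ENNReal) : EReal :=
  ⨅ (s : ℝ) (_ : 0 < s) (_ : mScale ρ b F ≤ ENNReal.ofReal s),
    ((c * meanLossExt ρ F s + Real.log s : ℝ) : EReal)

/-- `r(ε) = J[(1 - ε) F_{H,0,0} + ε δ_∞]`. -/
def cmR {p : ℕ} (ρ : ℝ → ℝ) (c b : ℝ) (H : Measure (ℝ × Regr p)) (ε : ℝ) : EReal :=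
  cmJ ρ c b (mix ε (absResidLaw H 0 0) (Measure.dirac ⊤))

/-- `m(t) = inf_{‖θ‖ = t} inf_α J[(1 - ε) F_{H,α,θ} + ε δ_0]`. -/
def cmM {p : ℕ} (ρ : ℝ → ℝ) (c b : ℝ) (H : Measure (ℝ × Regr p)) (ε : ℝ) (t : ℝ) : EReal :=
  ⨅ (θ : Regr p) (_ : ‖θ‖ = t) (α : ℝ),
    cmJ ρ c b (mix ε (absResidLaw H α θ) (Measure.dirac 0))

/-- The inverse of a nondecreasing function `m` on `[0, ∞)`, as a value in `[0, ∞]`: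
`m⁻¹(r) = sup {t ≥ 0 | m(t) ≤ r}`. -/
def incInverse (m : ℝ → EReal) (r : EReal) : ENNReal :=
  ⨆ (t : ℝ) (_ : 0 ≤ t) (_ : m t ≤ r), ENNReal.ofReal t

end CMRegression

end

namespace CMRegression

variable {p : ℕ} {ρ : ℝ → ℝ}

/-! ### Loss functions -/

/-! Contamination contributes a mean loss between `0` and `1`. Putting `0` in its place lowers the
profile at `(α, θ)` to at least `m(‖θ‖)`, and putting `1` in its place at the centre raises the
profile there to `r`. A solution thus satisfies `m(‖θ‖) ≤ profile(θ) ≤ profile(0) ≤ r`. A solution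
also exists as soon as `r < m(t)` for some `t`: slopes outside the ball of radius `t` cannot compete
with the centre, and inside it a minimizing sequence has a convergent subsequence. Hence the
estimate is undefined only if `m ≤ r` throughout, where the claimed bound is infinite
(`maxBias_le`).

Conversely let `m(t) < r`. A nearly optimal fit with slope norm `t` interpolates a point mass placed
on its hyperplane, so its objective stays below some `q < r` however remote that point is. If the
estimates had norms bounded by some `t' < t`, their residuals at the point would diverge as it moves
off, the contamination would cost its full mass in the limit, and the limiting fit would give `r ≤
q` (`ofReal_le_maxBias_of_lt`). Strict monotonicity of `m` then covers the case `m(t) = r`.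
Contamination `ε ≥ 1 - b` is separate: the objective can be driven to `-∞`.

The analytic core is that `E ρ((y - a) / s)` grows with `|a|` for a symmetric unimodal density
(`shiftLoss_le`, `shiftLoss_lt`). Hence the centre minimizes the mean loss at each scale, and
contracting `(α, θ)` radially lowers it, which makes `m` strictly increasing. Compactness comes from
bounding scales and intercepts at mean loss levels below `1` (`exists_subseq_tendsto`). Attainment
and the one-sided semicontinuity of `m` turn the supremum `m⁻¹(r)` into the equation `m(t) = r`. -/

lemma IsLoss.map_abs (h : IsLoss ρ) (u : ℝ) : ρ |u| = ρ u := by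
  rcases abs_cases u with ⟨e, -⟩ | ⟨e, -⟩ <;> rw [e]
  exact h.even u

lemma IsLoss.le_of_abs_le (h : IsLoss ρ) {u v : ℝ} (huv : |u| ≤ |v|) : ρ u ≤ ρ v := by
  rw [← h.map_abs u, ← h.map_abs v]
  exact h.mono (abs_nonneg u) (abs_nonneg v) huv

lemma IsLoss.nonneg (h : IsLoss ρ) (u : ℝ) : 0 ≤ ρ u := by
  rw [← h.map_zero]
  exact h.le_of_abs_le (by simp)

lemma IsLoss.le_one (h : IsLoss ρ) (u : ℝ) : ρ u ≤ 1 := by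
  refine ge_of_tendsto h.tendsto_one ?_
  filter_upwards [eventually_ge_atTop |u|] with v hv
  exact h.le_of_abs_le (hv.trans (le_abs_self v))

lemma IsLoss.measurable (h : IsLoss ρ) : Measurable ρ := by
  have hm : Monotone (fun u : ℝ => ρ (max u 0)) := fun u v huv =>
    h.mono (Set.mem_Ici.2 (le_max_right _ _)) (Set.mem_Ici.2 (le_max_right _ _))
      (max_le_max_right 0 huv)
  have : ρ = (fun u : ℝ => ρ (max u 0)) ∘ fun u => |u| := by
    ext u
    simp [h.map_abs]
  rw [this]
  exact hm.measurable.comp measurable_norm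

lemma IsLoss.tendsto_one_of_abs (h : IsLoss ρ) {ι : Type*} {l : Filter ι} {f : ι → ℝ}
    (hf : Tendsto (fun i => |f i|) l atTop) : Tendsto (fun i => ρ (f i)) l (𝓝 1) := by
  simpa [Function.comp_def, h.map_abs] using h.tendsto_one.comp hf

lemma IsLoss.integrable_comp (h : IsLoss ρ) {X : Type*} [MeasurableSpace X] {μ : Measure X}
    [IsFiniteMeasure μ] {g : X → ℝ} (hg : Measurable g) : Integrable (fun x => ρ (g x)) μ := by
  refine Integrable.of_bound (C := 1) (h.measurable.comp hg).aestronglyMeasurable ?_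
  filter_upwards with x
  rw [Real.norm_of_nonneg (h.nonneg _)]
  exact h.le_one _

/-- Unless the loss is `1` off the origin, some point separates smaller from larger values. -/
lemma IsLoss.exists_growth_point (h : IsLoss ρ) {u₁ : ℝ} (hu₁ : 0 < u₁) (h1 : ρ u₁ < 1) :
    ∃ u₀ > 0, ∀ v w : ℝ, |v| < u₀ → u₀ < |w| → ρ v < ρ w := by
  obtain ⟨M, hM⟩ := ((h.tendsto_one.eventually (lt_mem_nhds h1)).and
    (eventually_ge_atTop 0)).exists
  have hbdd : BddAbove {u | ρ u ≤ ρ u₁} := by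
    refine ⟨M, fun u hu => ?_⟩
    by_contra! hlt
    exact absurd (hM.1.trans_le (h.mono hM.2 (hM.2.trans hlt.le) hlt.le)) (not_lt.2 hu)
  have hmem : u₁ ∈ {u | ρ u ≤ ρ u₁} := le_refl (ρ u₁)
  refine ⟨sSup {u | ρ u ≤ ρ u₁}, hu₁.trans_le (le_csSup hbdd hmem), fun v w hv hw => ?_⟩
  obtain ⟨u, hu, hvu⟩ := exists_lt_of_lt_csSup ⟨u₁, hmem⟩ hv
  have h2 : ρ v ≤ ρ u := h.le_of_abs_le (hvu.le.trans (le_abs_self u))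
  have h3 : ρ u₁ < ρ w := by
    by_contra! hle
    rw [← h.map_abs] at hle
    exact absurd (le_csSup hbdd hle) (not_le.2 hw)
  exact (h2.trans hu).trans_lt h3

/-! ### Mean losses -/

lemma measurable_resid (α : ℝ) (θ : Regr p) (σ : ℝ) :
    Measurable fun z : ℝ × Regr p => (z.1 - α - inner ℝ z.2 θ) / σ := by
  fun_prop

lemma meanLoss_nonneg (hρ : IsLoss ρ) (H : Measure (ℝ × Regr p)) (α : ℝ) (θ : Regr p) (σ : ℝ) :
    0 ≤ meanLoss ρ H α θ σ :=
  integral_nonneg fun _ => hρ.nonneg _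

lemma meanLoss_le_one (hρ : IsLoss ρ) (H : Measure (ℝ × Regr p)) [IsProbabilityMeasure H]
    (α : ℝ) (θ : Regr p) (σ : ℝ) : meanLoss ρ H α θ σ ≤ 1 := by
  have := integral_mono (μ := H) (hρ.integrable_comp (measurable_resid α θ σ))
    (integrable_const (1 : ℝ)) (fun _ => hρ.le_one _)
  simpa [meanLoss] using this

lemma abs_div_le_abs_div {r s t : ℝ} (hs : 0 < s) (hst : s ≤ t) : |r / t| ≤ |r / s| := by
  rw [abs_div, abs_div, abs_of_pos hs, abs_of_pos (hs.trans_le hst)]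
  gcongr

lemma meanLoss_antitone (hρ : IsLoss ρ) (H : Measure (ℝ × Regr p)) [IsProbabilityMeasure H]
    (α : ℝ) (θ : Regr p) : AntitoneOn (meanLoss ρ H α θ) (Set.Ioi 0) := fun _ hs _ _ hst =>
  integral_mono (hρ.integrable_comp (measurable_resid α θ _))
    (hρ.integrable_comp (measurable_resid α θ _))
    fun _ => hρ.le_of_abs_le (abs_div_le_abs_div hs hst)

lemma integral_mix {X : Type*} [MeasurableSpace X] {μ ν : Measure X} {ε : ℝ} (hε0 : 0 ≤ ε)
    (hε1 : ε ≤ 1) {g : X → ℝ} (hμ : Integrable g μ) (hν : Integrable g ν) :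
    ∫ x, g x ∂(mix ε μ ν) = (1 - ε) * ∫ x, g x ∂μ + ε * ∫ x, g x ∂ν := by
  rw [mix, integral_add_measure (hμ.smul_measure ENNReal.ofReal_ne_top)
    (hν.smul_measure ENNReal.ofReal_ne_top), integral_smul_measure, integral_smul_measure,
    ENNReal.toReal_ofReal (by linarith), ENNReal.toReal_ofReal hε0]
  simp

lemma isProbabilityMeasure_mix {X : Type*} [MeasurableSpace X] (μ ν : Measure X)
    [IsProbabilityMeasure μ] [IsProbabilityMeasure ν] {ε : ℝ} (hε0 : 0 ≤ ε) (hε1 : ε ≤ 1) :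
    IsProbabilityMeasure (mix ε μ ν) := by
  refine ⟨?_⟩
  simp only [mix, Measure.add_apply, Measure.smul_apply, measure_univ, smul_eq_mul, mul_one]
  rw [← ENNReal.ofReal_add (by linarith) hε0]
  simp

lemma meanLoss_mix (hρ : IsLoss ρ) (H K : Measure (ℝ × Regr p)) [IsProbabilityMeasure H]
    [IsProbabilityMeasure K] {ε : ℝ} (hε0 : 0 ≤ ε) (hε1 : ε ≤ 1) (α : ℝ) (θ : Regr p) (σ : ℝ) :
    meanLoss ρ (mix ε H K) α θ σ
      = (1 - ε) * meanLoss ρ H α θ σ + ε * meanLoss ρ K α θ σ :=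
  integral_mix hε0 hε1 (hρ.integrable_comp (measurable_resid α θ _))
    (hρ.integrable_comp (measurable_resid α θ _))

lemma meanLoss_dirac (ρ : ℝ → ℝ) (z : ℝ × Regr p) (α : ℝ) (θ : Regr p) (σ : ℝ) :
    meanLoss ρ (Measure.dirac z) α θ σ = ρ ((z.1 - α - inner ℝ z.2 θ) / σ) := by
  simp [meanLoss, integral_dirac]

lemma measurable_lossExt (hρ : IsLoss ρ) : Measurable (lossExt ρ) :=
  Measurable.ite (measurableSet_singleton _) measurable_const
    (hρ.measurable.comp ENNReal.measurable_toReal)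

lemma measurable_lossExt_div (hρ : IsLoss ρ) (s : ℝ) :
    Measurable fun v : ENNReal => lossExt ρ (v / ENNReal.ofReal s) :=
  (measurable_lossExt hρ).comp (by fun_prop)

lemma lossExt_nonneg (hρ : IsLoss ρ) (v : ENNReal) : 0 ≤ lossExt ρ v := by
  unfold lossExt
  split_ifs
  exacts [zero_le_one, hρ.nonneg _]

lemma lossExt_le_one (hρ : IsLoss ρ) (v : ENNReal) : lossExt ρ v ≤ 1 := by
  unfold lossExt
  split_ifs
  exacts [le_rfl, hρ.le_one _]

lemma integrable_lossExt (hρ : IsLoss ρ) (F : Measure ENNReal) [IsFiniteMeasure F] (s : ℝ) :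
    Integrable (fun v => lossExt ρ (v / ENNReal.ofReal s)) F := by
  refine Integrable.of_bound (C := 1)
    (measurable_lossExt_div hρ s).aestronglyMeasurable ?_
  filter_upwards with x
  rw [Real.norm_of_nonneg (lossExt_nonneg hρ _)]
  exact lossExt_le_one hρ _

lemma lossExt_ofReal_abs_div (hρ : IsLoss ρ) (r : ℝ) {s : ℝ} (hs : 0 < s) :
    lossExt ρ (ENNReal.ofReal |r| / ENNReal.ofReal s) = ρ (r / s) := by
  rw [← ENNReal.ofReal_div_of_pos hs, lossExt, if_neg ENNReal.ofReal_ne_top,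
    ENNReal.toReal_ofReal (by positivity), ← hρ.map_abs (r / s), abs_div, abs_of_pos hs]

lemma measurable_absResid (α : ℝ) (θ : Regr p) :
    Measurable fun z : ℝ × Regr p => ENNReal.ofReal |z.1 - α - inner ℝ z.2 θ| := by
  fun_prop

instance (H : Measure (ℝ × Regr p)) [IsProbabilityMeasure H] (α : ℝ) (θ : Regr p) :
    IsProbabilityMeasure (absResidLaw H α θ) :=
  Measure.isProbabilityMeasure_map (measurable_absResid α θ).aemeasurable

lemma meanLossExt_absResidLaw (hρ : IsLoss ρ) (H : Measure (ℝ × Regr p)) (α : ℝ) (θ : Regr p)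
    {s : ℝ} (hs : 0 < s) :
    meanLossExt ρ (absResidLaw H α θ) s = meanLoss ρ H α θ s := by
  rw [meanLossExt, absResidLaw, integral_map (measurable_absResid α θ).aemeasurable
    (measurable_lossExt_div hρ s).aestronglyMeasurable]
  simp only [lossExt_ofReal_abs_div hρ _ hs, meanLoss]

lemma meanLossExt_mix_zero (hρ : IsLoss ρ) (H : Measure (ℝ × Regr p)) [IsProbabilityMeasure H]
    {ε : ℝ} (hε0 : 0 ≤ ε) (hε1 : ε ≤ 1) (α : ℝ) (θ : Regr p) {s : ℝ} (hs : 0 < s) :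
    meanLossExt ρ (mix ε (absResidLaw H α θ) (Measure.dirac 0)) s
      = (1 - ε) * meanLoss ρ H α θ s := by
  rw [meanLossExt, integral_mix hε0 hε1 (integrable_lossExt hρ _ s) (integrable_lossExt hρ _ s),
    ← meanLossExt, meanLossExt_absResidLaw hρ H α θ hs, integral_dirac]
  simp [lossExt, hρ.map_zero]

lemma meanLossExt_mix_top (hρ : IsLoss ρ) (H : Measure (ℝ × Regr p)) [IsProbabilityMeasure H]
    {ε : ℝ} (hε0 : 0 ≤ ε) (hε1 : ε ≤ 1) (α : ℝ) (θ : Regr p) {s : ℝ} (hs : 0 < s) :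
    meanLossExt ρ (mix ε (absResidLaw H α θ) (Measure.dirac ⊤)) s
      = (1 - ε) * meanLoss ρ H α θ s + ε := by
  rw [meanLossExt, integral_mix hε0 hε1 (integrable_lossExt hρ _ s) (integrable_lossExt hρ _ s),
    ← meanLossExt, meanLossExt_absResidLaw hρ H α θ hs, integral_dirac]
  simp [lossExt, ENNReal.top_div]

/-! ### The constrained infimum over scales -/

/-- The infimum of `c e(s) + log s` over the scales `s > 0` with `e(s) ≤ b`. -/
noncomputable def scaleProfile (c b : ℝ) (e : ℝ → ℝ) : EReal :=
  ⨅ (s : ℝ) (_ : 0 < s) (_ : e s ≤ b), ((c * e s + Real.log s : ℝ) : EReal)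

lemma scaleProfile_le {c b : ℝ} {e : ℝ → ℝ} {s : ℝ} (hs : 0 < s) (he : e s ≤ b) :
    scaleProfile c b e ≤ ((c * e s + Real.log s : ℝ) : EReal) :=
  iInf_le_of_le s (iInf_le_of_le hs (iInf_le _ he))

lemma scaleProfile_lt_iff {c b : ℝ} {e : ℝ → ℝ} {x : EReal} :
    scaleProfile c b e < x ↔
      ∃ s : ℝ, 0 < s ∧ e s ≤ b ∧ ((c * e s + Real.log s : ℝ) : EReal) < x := by
  simp only [scaleProfile, iInf_lt_iff, exists_prop]

lemma le_scaleProfile_iff {c b : ℝ} {e : ℝ → ℝ} {x : EReal} :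
    x ≤ scaleProfile c b e ↔
      ∀ s : ℝ, 0 < s → e s ≤ b → x ≤ ((c * e s + Real.log s : ℝ) : EReal) := by
  simp only [scaleProfile, le_iInf_iff]

lemma scaleProfile_congr {c b : ℝ} {e e' : ℝ → ℝ} (h : ∀ s, 0 < s → e s = e' s) :
    scaleProfile c b e = scaleProfile c b e' := by
  refine iInf_congr fun s => iInf_congr fun hs => ?_
  rw [h s hs]

lemma scaleProfile_mono {c b : ℝ} (hc : 0 < c) {e e' : ℝ → ℝ} (h : ∀ s, 0 < s → e s ≤ e' s) :
    scaleProfile c b e ≤ scaleProfile c b e' := by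
  refine le_scaleProfile_iff.2 fun s hs he => (scaleProfile_le hs ((h s hs).trans he)).trans ?_
  have := h s hs
  rw [EReal.coe_le_coe_iff]
  gcongr

/-- Letting `s'` decrease to `s` costs only a vanishing change in `log`. This replaces
left-continuity of the loss: the constraint may fail at `s` itself. -/
lemma scaleProfile_le_of_forall_gt {c b : ℝ} {e : ℝ → ℝ} {s w : ℝ} (hs : 0 < s)
    (he : ∀ s' > s, e s' ≤ b) (hw : ∀ s' > s, c * e s' ≤ w) :
    scaleProfile c b e ≤ ((w + Real.log s : ℝ) : EReal) := by
  have ht : Tendsto (fun s' : ℝ => ((w + Real.log s' : ℝ) : EReal)) (𝓝[>] s)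
      (𝓝 ((w + Real.log s : ℝ) : EReal)) := by
    refine (continuous_coe_real_ereal.tendsto _).comp ?_
    exact (((Real.continuousAt_log hs.ne').tendsto.const_add w)).mono_left nhdsWithin_le_nhds
  refine ge_of_tendsto ht ?_
  filter_upwards [self_mem_nhdsWithin] with s' hs'
  refine (scaleProfile_le (hs.trans hs') (he s' hs')).trans ?_
  rw [EReal.coe_le_coe_iff]
  exact add_le_add_left (hw s' hs') _

/-- If every scale is admissible then the objective is unbounded below. -/
lemma scaleProfile_eq_bot {c b : ℝ} (hc : 0 < c) {e : ℝ → ℝ} (he : ∀ s, 0 < s → e s ≤ b) :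
    scaleProfile c b e = ⊥ := by
  refine eq_bot_iff.2 (le_of_forall_gt fun x hx => ?_)
  obtain ⟨y, -, hy⟩ := EReal.lt_iff_exists_real_btwn.1 hx
  refine lt_of_le_of_lt (scaleProfile_le (Real.exp_pos (y - c * b)) (he _ (Real.exp_pos _))) ?_
  refine lt_of_le_of_lt ?_ hy
  rw [Real.log_exp, EReal.coe_le_coe_iff]
  have := mul_le_mul_of_nonneg_left (he _ (Real.exp_pos (y - c * b))) hc.le
  linarith

/-- The constraints `s ≥ σ(F)` and `E_F ρ(y / s) ≤ b` can differ only at the single point `s =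
σ(F)`, and a decreasing limit of scales shows that this point does not change the infimum. -/
lemma cmJ_eq_scaleProfile {c b : ℝ} (hc : 0 < c) {F : Measure ENNReal}
    (hF : AntitoneOn (meanLossExt ρ F) (Set.Ioi 0)) :
    cmJ ρ c b F = scaleProfile c b (meanLossExt ρ F) := by
  apply le_antisymm
  · refine le_scaleProfile_iff.2 fun s hs he => ?_
    exact iInf_le_of_le s (iInf_le_of_le hs
      (iInf_le _ (iInf_le_of_le s (iInf_le_of_le hs (iInf_le _ he)))))
  · refine le_iInf fun s => le_iInf fun hs => le_iInf fun hm => ?_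
    refine scaleProfile_le_of_forall_gt hs (fun s' hs' => ?_) (fun s' hs' => ?_)
    · have hlt : mScale ρ b F < ENNReal.ofReal s' :=
        hm.trans_lt ((ENNReal.ofReal_lt_ofReal_iff (hs.trans hs')).2 hs')
      simp only [mScale, iInf_lt_iff] at hlt
      obtain ⟨u, hu, hub, hus⟩ := hlt
      have hus' := (ENNReal.ofReal_lt_ofReal_iff (hs.trans hs')).1 hus
      exact (hF hu (hs.trans hs') hus'.le).trans hub
    · exact mul_le_mul_of_nonneg_left (hF hs (hs.trans hs') (le_of_lt hs')) hc.le

lemma cmJ_mix_zero (hρ : IsLoss ρ) {c b : ℝ} (hc : 0 < c) (H : Measure (ℝ × Regr p))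
    [IsProbabilityMeasure H] {ε : ℝ} (hε0 : 0 ≤ ε) (hε1 : ε ≤ 1) (α : ℝ) (θ : Regr p) :
    cmJ ρ c b (mix ε (absResidLaw H α θ) (Measure.dirac 0))
      = scaleProfile c b (fun s => (1 - ε) * meanLoss ρ H α θ s) := by
  have key := fun (s : ℝ) (hs : 0 < s) => meanLossExt_mix_zero hρ H hε0 hε1 α θ hs
  rw [cmJ_eq_scaleProfile hc, scaleProfile_congr key]
  intro s hs t ht hst
  rw [key s hs, key t ht]
  exact mul_le_mul_of_nonneg_left (meanLoss_antitone hρ H α θ hs ht hst) (by linarith)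

lemma cmR_eq (hρ : IsLoss ρ) {c b : ℝ} (hc : 0 < c) (H : Measure (ℝ × Regr p))
    [IsProbabilityMeasure H] {ε : ℝ} (hε0 : 0 ≤ ε) (hε1 : ε ≤ 1) :
    cmR ρ c b H ε = scaleProfile c b (fun s => (1 - ε) * meanLoss ρ H 0 0 s + ε) := by
  have key := fun (s : ℝ) (hs : 0 < s) => meanLossExt_mix_top hρ H hε0 hε1 0 0 hs
  rw [cmR, cmJ_eq_scaleProfile hc, scaleProfile_congr key]
  intro s hs t ht hst
  rw [key s hs, key t ht]
  have := mul_le_mul_of_nonneg_left (meanLoss_antitone hρ H 0 0 hs ht hst)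
    (by linarith : (0 : ℝ) ≤ 1 - ε)
  linarith

/-! ### The error law -/

lemma density_lt_of_abs_lt {f : ℝ → ℝ} (hs : ∀ u, f (-u) = f u) (hc : Continuous f)
    (hf : StrictAntiOn f (Set.Ioi 0)) {u v : ℝ} (huv : |v| < |u|) : f u < f v := by
  have habs : ∀ u, f |u| = f u := fun u => by
    rcases abs_cases u with ⟨e, -⟩ | ⟨e, -⟩ <;> rw [e]
    exact hs u
  rw [← habs u, ← habs v]
  have hu : 0 < |u| := (abs_nonneg v).trans_lt huv
  rcases (abs_nonneg v).eq_or_lt with h0 | h0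
  · rw [← h0]
    -- Strict decrease is available only on the open half line, so `0` is reached by continuity,
    -- with `|u| / 2` securing strictness.
    refine (hf (half_pos hu) hu (half_lt_self hu)).trans_le ?_
    refine ge_of_tendsto (hc.continuousAt.tendsto.mono_left nhdsWithin_le_nhds :
      Tendsto f (𝓝[>] 0) (𝓝 (f 0))) ?_
    filter_upwards [Ioo_mem_nhdsGT (half_pos hu)] with x hx
    exact (hf hx.1 (half_pos hu) hx.2).le
  · exact hf h0 hu huv

lemma density_le_of_abs_le {f : ℝ → ℝ} (hs : ∀ u, f (-u) = f u) (hc : Continuous f)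
    (hf : StrictAntiOn f (Set.Ioi 0)) {u v : ℝ} (huv : |v| ≤ |u|) : f u ≤ f v := by
  rcases huv.lt_or_eq with h | h
  · exact (density_lt_of_abs_lt hs hc hf h).le
  · rcases abs_eq_abs.1 h with h | h
    · rw [h]
    · rw [h, hs]

lemma density_pos {f : ℝ → ℝ} (h0 : ∀ u, 0 ≤ f u) (hs : ∀ u, f (-u) = f u) (hc : Continuous f)
    (hf : StrictAntiOn f (Set.Ioi 0)) (u : ℝ) : 0 < f u :=
  (h0 (|u| + 1)).trans_lt (density_lt_of_abs_lt hs hc hf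
    (by rw [abs_of_nonneg (by positivity : 0 ≤ |u| + 1)]; linarith))

lemma IsErrorLaw.nullSingletonClass {F : Measure ℝ} (hF : IsErrorLaw F) :
    NullSingletonClass F := by
  obtain ⟨f, -, -, -, -, rfl⟩ := hF
  exact nullSingletonClass_withDensity _

lemma IsErrorLaw.isOpenPosMeasure {F : Measure ℝ} (hF : IsErrorLaw F) :
    F.IsOpenPosMeasure := by
  obtain ⟨f, h0, hs, hc, hf, rfl⟩ := hF
  refine ⟨fun U hU hne h => ?_⟩
  rw [withDensity_apply_eq_zero (by fun_prop)] at h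
  refine (hU.measure_pos volume hne).ne' ?_
  convert h using 2
  ext x
  simp [density_pos h0 hs hc hf x]

/-- The mean loss of the error shifted by `a`. -/
noncomputable def shiftLoss (ρ : ℝ → ℝ) (F : Measure ℝ) (s a : ℝ) : ℝ :=
  ∫ y, ρ ((y - a) / s) ∂F

/-- The substitutions `y = m + w` and `y = m - w` give two expressions for the same difference;
adding them produces the factor `2` and pairs reflected points about the midpoint `m` of the two
shifts. -/
lemma shiftLoss_sub_eq (hρ : IsLoss ρ) {f : ℝ → ℝ} (h0 : ∀ u, 0 ≤ f u) (hc : Continuous f)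
    [IsProbabilityMeasure (volume.withDensity fun u => ENNReal.ofReal (f u))] (s m δ : ℝ) :
    Integrable (fun w => (ρ ((w - δ) / s) - ρ ((w + δ) / s)) * (f (m + w) - f (m - w))) ∧
    2 * (shiftLoss ρ (volume.withDensity fun u => ENNReal.ofReal (f u)) s (m + δ)
      - shiftLoss ρ (volume.withDensity fun u => ENNReal.ofReal (f u)) s (m - δ))
      = ∫ w, (ρ ((w - δ) / s) - ρ ((w + δ) / s)) * (f (m + w) - f (m - w)) := by
  have hfm : Measurable fun u => ENNReal.ofReal (f u) := by fun_prop
  have hlt : ∀ᵐ u, ENNReal.ofReal (f u) < ⊤ := ae_of_all _ fun _ => ENNReal.ofReal_lt_top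
  set F := volume.withDensity fun u => ENNReal.ofReal (f u) with hFdef
  have hint : ∀ a, Integrable (fun y => ρ ((y - a) / s)) F := fun a =>
    hρ.integrable_comp (by fun_prop)
  have hd := (hint (m + δ)).sub (hint (m - δ))
  have hd' := (integrable_withDensity_iff_integrable_smul' hfm hlt).1 hd
  simp only [ENNReal.toReal_ofReal (h0 _), smul_eq_mul, Pi.sub_apply] at hd'
  have e : shiftLoss ρ F s (m + δ) - shiftLoss ρ F s (m - δ)
      = ∫ y, f y * (ρ ((y - (m + δ)) / s) - ρ ((y - (m - δ)) / s)) := by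
    rw [shiftLoss, shiftLoss, ← integral_sub (hint _) (hint _), hFdef,
      integral_withDensity_eq_integral_toReal_smul hfm hlt]
    simp only [ENNReal.toReal_ofReal (h0 _), smul_eq_mul]
  have i1 := hd'.comp_add_left m
  have e1 := integral_add_left_eq_self (μ := (volume : Measure ℝ))
    (fun y => f y * (ρ ((y - (m + δ)) / s) - ρ ((y - (m - δ)) / s))) m
  have i2 := i1.comp_neg
  have e2 := integral_neg_eq_self (μ := (volume : Measure ℝ))
    (fun w => f (m + w) * (ρ ((m + w - (m + δ)) / s) - ρ ((m + w - (m - δ)) / s)))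
  have hfun : (fun w => (ρ ((w - δ) / s) - ρ ((w + δ) / s)) * (f (m + w) - f (m - w)))
      = fun w => f (m + w) * (ρ ((m + w - (m + δ)) / s) - ρ ((m + w - (m - δ)) / s))
        + f (m + -w) * (ρ ((m + -w - (m + δ)) / s) - ρ ((m + -w - (m - δ)) / s)) := by
    ext w
    have a1 : ρ ((m + -w - (m + δ)) / s) = ρ ((w + δ) / s) := by
      rw [← hρ.even]; congr 1; ring
    have a2 : ρ ((m + -w - (m - δ)) / s) = ρ ((w - δ) / s) := by
      rw [← hρ.even]; congr 1; ring
    have a3 : m + w - (m + δ) = w - δ := by ring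
    have a4 : m + w - (m - δ) = w + δ := by ring
    rw [a1, a2, a3, a4, ← sub_eq_add_neg]
    ring
  rw [hfun]
  refine ⟨i1.add i2, ?_⟩
  rw [integral_add i1 i2, e2, e1, e]
  ring

/-- Both factors are nonpositive for `w ≥ 0` and nonnegative for `w ≤ 0`, because `w ≥ 0` puts `w -
δ` nearer the origin than `w + δ`, and `m - w` nearer than `m + w`. -/
lemma mul_nonneg_of_reflection (hρ : IsLoss ρ) {f : ℝ → ℝ} (hs : ∀ u, f (-u) = f u)
    (hc : Continuous f) (hf : StrictAntiOn f (Set.Ioi 0)) (s : ℝ) {m δ : ℝ} (hm : 0 ≤ m)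
    (hδ : 0 ≤ δ) (w : ℝ) :
    0 ≤ (ρ ((w - δ) / s) - ρ ((w + δ) / s)) * (f (m + w) - f (m - w)) := by
  rcases le_total 0 w with hw | hw
  · refine mul_nonneg_of_nonpos_of_nonpos (sub_nonpos.2 (hρ.le_of_abs_le ?_))
      (sub_nonpos.2 (density_le_of_abs_le hs hc hf ?_))
    · rw [abs_div, abs_div]
      gcongr ?_ / _
      exact abs_le_abs (by linarith) (by linarith)
    · exact abs_le_abs (by linarith) (by linarith)
  · refine mul_nonneg (sub_nonneg.2 (hρ.le_of_abs_le ?_))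
      (sub_nonneg.2 (density_le_of_abs_le hs hc hf ?_))
    · rw [abs_div, abs_div, abs_sub_comm]
      gcongr ?_ / _
      exact abs_le_abs (by linarith) (by linarith)
    · rw [← sq_le_sq]
      nlinarith

lemma shiftLoss_neg (hρ : IsLoss ρ) {F : Measure ℝ} (hF : IsErrorLaw F) (s a : ℝ) :
    shiftLoss ρ F s (-a) = shiftLoss ρ F s a := by
  obtain ⟨f, h0, hs, hc, hf, rfl⟩ := hF
  have hfm : Measurable fun u => ENNReal.ofReal (f u) := by fun_prop
  have hlt : ∀ᵐ u, ENNReal.ofReal (f u) < ⊤ := ae_of_all _ fun _ => ENNReal.ofReal_lt_top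
  rw [shiftLoss, shiftLoss, integral_withDensity_eq_integral_toReal_smul hfm hlt,
    integral_withDensity_eq_integral_toReal_smul hfm hlt, ← integral_neg_eq_self]
  refine integral_congr_ae (ae_of_all _ fun y => ?_)
  have : ρ ((-y - -a) / s) = ρ ((y - a) / s) := by
    rw [← hρ.even]; congr 1; ring
  simp only [hs, this]

lemma shiftLoss_abs (hρ : IsLoss ρ) {F : Measure ℝ} (hF : IsErrorLaw F) (s a : ℝ) :
    shiftLoss ρ F s |a| = shiftLoss ρ F s a := by
  rcases abs_cases a with ⟨e, -⟩ | ⟨e, -⟩ <;> rw [e]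
  exact shiftLoss_neg hρ hF s a

lemma shiftLoss_le (hρ : IsLoss ρ) {F : Measure ℝ} [IsProbabilityMeasure F] (hF : IsErrorLaw F)
    (s : ℝ) {a₁ a₂ : ℝ} (h : |a₁| ≤ |a₂|) : shiftLoss ρ F s a₁ ≤ shiftLoss ρ F s a₂ := by
  rw [← shiftLoss_abs hρ hF s a₁, ← shiftLoss_abs hρ hF s a₂]
  obtain ⟨f, h0, hs, hc, hf, rfl⟩ := hF
  have key := (shiftLoss_sub_eq hρ h0 hc s ((|a₁| + |a₂|) / 2) ((|a₂| - |a₁|) / 2)).2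
  have hn := mul_nonneg_of_reflection hρ hs hc hf s (m := (|a₁| + |a₂|) / 2)
    (δ := (|a₂| - |a₁|) / 2) (by positivity) (by linarith)
  have hn : 0 ≤ ∫ w, (ρ ((w - (|a₂| - |a₁|) / 2) / s) - ρ ((w + (|a₂| - |a₁|) / 2) / s))
      * (f ((|a₁| + |a₂|) / 2 + w) - f ((|a₁| + |a₂|) / 2 - w)) := integral_nonneg hn
  rw [← key, show (|a₁| + |a₂|) / 2 + (|a₂| - |a₁|) / 2 = |a₂| by ring,
    show (|a₁| + |a₂|) / 2 - (|a₂| - |a₁|) / 2 = |a₁| by ring] at hn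
  linarith

lemma shiftLoss_lt (hρ : IsLoss ρ) {u₁ : ℝ} (hu₁ : 0 < u₁) (h1 : ρ u₁ < 1) {F : Measure ℝ}
    [IsProbabilityMeasure F] (hF : IsErrorLaw F) {s : ℝ} (hs0 : 0 < s) {a₁ a₂ : ℝ}
    (h : |a₁| < |a₂|) : shiftLoss ρ F s a₁ < shiftLoss ρ F s a₂ := by
  obtain ⟨u₀, hu₀, hgrow⟩ := hρ.exists_growth_point hu₁ h1
  rw [← shiftLoss_abs hρ hF s a₁, ← shiftLoss_abs hρ hF s a₂]
  obtain ⟨f, h0, hs, hc, hf, rfl⟩ := hF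
  obtain ⟨hint, key⟩ := shiftLoss_sub_eq hρ h0 hc s ((|a₁| + |a₂|) / 2) ((|a₂| - |a₁|) / 2)
  have hn := mul_nonneg_of_reflection hρ hs hc hf s (m := (|a₁| + |a₂|) / 2)
    (δ := (|a₂| - |a₁|) / 2) (by positivity) (by linarith)
  have hm : 0 < (|a₁| + |a₂|) / 2 := by linarith [abs_nonneg a₁]
  have hδ : 0 < (|a₂| - |a₁|) / 2 := by linarith
  have hpos : 0 < ∫ w, (ρ ((w - (|a₂| - |a₁|) / 2) / s) - ρ ((w + (|a₂| - |a₁|) / 2) / s))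
      * (f ((|a₁| + |a₂|) / 2 + w) - f ((|a₁| + |a₂|) / 2 - w)) := by
    rw [integral_pos_iff_support_of_nonneg hn hint]
    set m := (|a₁| + |a₂|) / 2
    set δ := (|a₂| - |a₁|) / 2
    -- On this open set `w - δ` and `w + δ` are separated by the growth point at scale `s`, so the
    -- loss factor is nonzero, and `w > 0` makes the density factor nonzero.
    have hopen : IsOpen ({w | 0 < w} ∩ {w | |w - δ| < u₀ * s} ∩ {w : ℝ | u₀ * s < w + δ}) :=
      ((isOpen_lt continuous_const continuous_id).inter
        (isOpen_lt (by fun_prop) continuous_const)).inter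
        (isOpen_lt continuous_const (by fun_prop))
    have hus : 0 < u₀ * s := mul_pos hu₀ hs0
    have hne : ({w | 0 < w} ∩ {w | |w - δ| < u₀ * s} ∩ {w : ℝ | u₀ * s < w + δ}).Nonempty := by
      refine ⟨max (u₀ * s) δ, ⟨lt_max_of_lt_left hus, ?_⟩, ?_⟩
      · show |max (u₀ * s) δ - δ| < u₀ * s
        rw [abs_of_nonneg (sub_nonneg.2 (le_max_right _ _)), sub_lt_iff_lt_add]
        exact max_lt (by linarith) (by linarith)
      · show u₀ * s < max (u₀ * s) δ + δ
        linarith [le_max_left (u₀ * s) δ]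
    refine (hopen.measure_pos volume hne).trans_le (measure_mono ?_)
    rintro w ⟨⟨hw, hw1⟩, hw2⟩
    change 0 < w at hw
    change |w - δ| < u₀ * s at hw1
    change u₀ * s < w + δ at hw2
    refine mul_ne_zero (sub_neg.2 (hgrow _ _ ?_ ?_)).ne
      (sub_neg.2 (density_lt_of_abs_lt hs hc hf ?_)).ne
    · rwa [abs_div, abs_of_pos hs0, div_lt_iff₀ hs0]
    · rwa [abs_div, abs_of_pos hs0, lt_div_iff₀ hs0, abs_of_pos (by linarith)]
    · rw [← sq_lt_sq]
      nlinarith [mul_pos hm hw]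
  rw [← key, show (|a₁| + |a₂|) / 2 + (|a₂| - |a₁|) / 2 = |a₂| by ring,
    show (|a₁| + |a₂|) / 2 - (|a₂| - |a₁|) / 2 = |a₁| by ring] at hpos
  linarith

/-! ### Continuity, monotonicity and coercivity of the mean loss under the central model -/

/-- For fixed `x` the scaled residual is injective in `y`, and the error law has no atoms; Fubini
does the rest. -/
lemma ae_resid_div_notMem {F : Measure ℝ} [IsProbabilityMeasure F] (hF : IsErrorLaw F)
    (G : Measure (Regr p)) [IsProbabilityMeasure G] {D : Set ℝ} (hD : D.Countable) (α : ℝ)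
    (θ : Regr p) {σ : ℝ} (hσ : σ ≠ 0) :
    ∀ᵐ z ∂(F.prod G), (z.1 - α - inner ℝ z.2 θ) / σ ∉ D := by
  have := hF.nullSingletonClass
  rw [ae_iff]
  have hset : {z : ℝ × Regr p | ¬(z.1 - α - inner ℝ z.2 θ) / σ ∉ D}
      = (fun z : ℝ × Regr p => (z.1 - α - inner ℝ z.2 θ) / σ) ⁻¹' D := by
    ext z
    simp
  rw [hset, Measure.prod_apply_symm (measurable_resid α θ σ hD.measurableSet),
    lintegral_eq_zero_iff' (by
      exact (measurable_measure_prodMk_right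
        (measurable_resid α θ σ hD.measurableSet)).aemeasurable)]
  refine ae_of_all _ fun x => ?_
  have hinj : Function.Injective fun y : ℝ => (y - α - inner ℝ x θ) / σ := fun y y' h => by
    have := (div_left_inj' hσ).1 h
    linarith
  exact (hD.preimage hinj).measure_zero F

lemma tendsto_integral_loss (hρ : IsLoss ρ) {X ι : Type*} [MeasurableSpace X] {μ : Measure X}
    [IsFiniteMeasure μ] {l : Filter ι} [l.IsCountablyGenerated] {g : ι → X → ℝ}
    (hg : ∀ i, Measurable (g i)) {k : X → ℝ}
    (h : ∀ᵐ x ∂μ, Tendsto (fun i => ρ (g i x)) l (𝓝 (k x))) :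
    Tendsto (fun i => ∫ x, ρ (g i x) ∂μ) l (𝓝 (∫ x, k x ∂μ)) := by
  refine tendsto_integral_filter_of_dominated_convergence (fun _ => 1)
    (Eventually.of_forall fun i => (hρ.measurable.comp (hg i)).aestronglyMeasurable)
    (Eventually.of_forall fun i => ae_of_all _ fun x => ?_) (integrable_const _) h
  rw [Real.norm_of_nonneg (hρ.nonneg _)]
  exact hρ.le_one _

lemma tendsto_resid_div {ι : Type*} {l : Filter ι} {a s : ι → ℝ} {t : ι → Regr p} {α σ : ℝ}
    {θ : Regr p} (ha : Tendsto a l (𝓝 α)) (ht : Tendsto t l (𝓝 θ)) (hs : Tendsto s l (𝓝 σ))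
    (hσ : 0 < σ) (z : ℝ × Regr p) :
    Tendsto (fun i => (z.1 - a i - inner ℝ z.2 (t i)) / s i) l
      (𝓝 ((z.1 - α - inner ℝ z.2 θ) / σ)) :=
  ((tendsto_const_nhds.sub ha).sub (tendsto_const_nhds.inner ht)).div hs hσ.ne'

/-- Almost every limiting residual avoids the finitely many discontinuities of `ρ`, so dominated
convergence applies. -/
lemma tendsto_meanLoss (hρ : IsLoss ρ) {F : Measure ℝ} [IsProbabilityMeasure F]
    (hF : IsErrorLaw F) (G : Measure (Regr p)) [IsProbabilityMeasure G] {ι : Type*}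
    {l : Filter ι} [l.IsCountablyGenerated] {a s : ι → ℝ} {t : ι → Regr p} {α σ : ℝ}
    {θ : Regr p} (ha : Tendsto a l (𝓝 α)) (ht : Tendsto t l (𝓝 θ)) (hs : Tendsto s l (𝓝 σ))
    (hσ : 0 < σ) :
    Tendsto (fun i => meanLoss ρ (F.prod G) (a i) (t i) (s i)) l
      (𝓝 (meanLoss ρ (F.prod G) α θ σ)) := by
  refine tendsto_integral_loss hρ (fun i => measurable_resid _ _ _) ?_
  filter_upwards [ae_resid_div_notMem hF G hρ.finite_discont.countable α θ hσ.ne'] with z hz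
  have hcont : ContinuousAt ρ ((z.1 - α - inner ℝ z.2 θ) / σ) := by
    by_contra hn
    exact hz hn
  exact hcont.tendsto.comp (tendsto_resid_div ha ht hs hσ z)

/-- Lower semicontinuity of the mean loss, up to an increase of the scale. -/
lemma meanLoss_le_of_tendsto (hρ : IsLoss ρ) (H : Measure (ℝ × Regr p)) [IsProbabilityMeasure H]
    {a s q : ℕ → ℝ} {t : ℕ → Regr p} {α σ σ' Q : ℝ} {θ : Regr p}
    (ha : Tendsto a atTop (𝓝 α)) (ht : Tendsto t atTop (𝓝 θ)) (hs : Tendsto s atTop (𝓝 σ))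
    (hσ : 0 < σ) (hσ' : σ < σ') (hle : ∀ n, meanLoss ρ H (a n) (t n) (s n) ≤ q n)
    (hq : Tendsto q atTop (𝓝 Q)) : meanLoss ρ H α θ σ' ≤ Q := by
  -- The strictly larger scale leaves slack: the loss at the limit with scale `σ'` is eventually
  -- below the approximating loss pointwise, so the minimum of the two stabilizes. No continuity of
  -- `ρ` or of `H` is needed.
  have hlim : Tendsto (fun n => ∫ z, min (ρ ((z.1 - a n - inner ℝ z.2 (t n)) / s n))
      (ρ ((z.1 - α - inner ℝ z.2 θ) / σ')) ∂H) atTop (𝓝 (meanLoss ρ H α θ σ')) := by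
    refine tendsto_integral_of_dominated_convergence (fun _ => 1) (fun n =>
      ((hρ.measurable.comp (measurable_resid _ _ _)).min
        (hρ.measurable.comp (measurable_resid _ _ _))).aestronglyMeasurable)
      (integrable_const _) (fun n => ae_of_all _ fun z => ?_) (ae_of_all _ fun z => ?_)
    · rw [Real.norm_of_nonneg (le_min (hρ.nonneg _) (hρ.nonneg _))]
      exact (min_le_left _ _).trans (hρ.le_one _)
    · refine tendsto_const_nhds.congr' ?_
      have hev : ∀ᶠ n in atTop, ρ ((z.1 - α - inner ℝ z.2 θ) / σ')
          ≤ ρ ((z.1 - a n - inner ℝ z.2 (t n)) / s n) := by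
        rcases eq_or_ne (z.1 - α - inner ℝ z.2 θ) 0 with h0 | h0
        · simp [h0, hρ.map_zero, hρ.nonneg]
        · have hlt : |(z.1 - α - inner ℝ z.2 θ) / σ'| < |(z.1 - α - inner ℝ z.2 θ) / σ| := by
            rw [abs_div, abs_div, abs_of_pos hσ, abs_of_pos (hσ.trans hσ')]
            have := abs_pos.2 h0
            gcongr
          filter_upwards [(tendsto_resid_div ha ht hs hσ z).abs.eventually (lt_mem_nhds hlt)]
            with n hn
          exact hρ.le_of_abs_le hn.le
      filter_upwards [hev] with n hn
      rw [min_eq_right hn]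
  refine le_of_tendsto_of_tendsto' hlim hq fun n => (integral_mono ?_ ?_ ?_).trans (hle n)
  · exact (hρ.integrable_comp (measurable_resid _ _ _)).inf
      (hρ.integrable_comp (measurable_resid _ _ _))
  · exact hρ.integrable_comp (measurable_resid _ _ _)
  · exact fun z => min_le_left _ _

lemma resid_eq (α : ℝ) (θ x : Regr p) (y : ℝ) :
    y - α - inner ℝ x θ = y - (α + inner ℝ x θ) := by
  ring

lemma integrable_shiftLoss (hρ : IsLoss ρ) (F : Measure ℝ) [IsProbabilityMeasure F]
    (G : Measure (Regr p)) [IsProbabilityMeasure G] (α : ℝ) (θ : Regr p) (s : ℝ) :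
    Integrable (fun x => shiftLoss ρ F s (α + inner ℝ x θ)) G := by
  have := (hρ.integrable_comp (μ := F.prod G) (measurable_resid α θ s)).integral_prod_right
  simpa only [shiftLoss, resid_eq] using this

lemma meanLoss_prod (hρ : IsLoss ρ) (F : Measure ℝ) [IsProbabilityMeasure F]
    (G : Measure (Regr p)) [IsProbabilityMeasure G] (α : ℝ) (θ : Regr p) (s : ℝ) :
    meanLoss ρ (F.prod G) α θ s = ∫ x, shiftLoss ρ F s (α + inner ℝ x θ) ∂G := by
  rw [meanLoss, integral_prod_symm _ (hρ.integrable_comp (measurable_resid α θ s))]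
  simp only [shiftLoss, resid_eq]

lemma meanLoss_smul_le (hρ : IsLoss ρ) {F : Measure ℝ} [IsProbabilityMeasure F]
    (hF : IsErrorLaw F) (G : Measure (Regr p)) [IsProbabilityMeasure G] (α : ℝ) (θ : Regr p)
    (s : ℝ) {r : ℝ} (hr0 : 0 ≤ r) (hr1 : r ≤ 1) :
    meanLoss ρ (F.prod G) (r * α) (r • θ) s ≤ meanLoss ρ (F.prod G) α θ s := by
  rw [meanLoss_prod hρ, meanLoss_prod hρ]
  refine integral_mono (integrable_shiftLoss hρ F G _ _ s) (integrable_shiftLoss hρ F G _ _ s)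
    fun x => shiftLoss_le hρ hF s ?_
  rw [inner_smul_right, ← mul_add, abs_mul, abs_of_nonneg hr0]
  exact mul_le_of_le_one_left (abs_nonneg _) hr1

lemma meanLoss_zero_le (hρ : IsLoss ρ) {F : Measure ℝ} [IsProbabilityMeasure F]
    (hF : IsErrorLaw F) (G : Measure (Regr p)) [IsProbabilityMeasure G] (α : ℝ) (θ : Regr p)
    (s : ℝ) : meanLoss ρ (F.prod G) 0 0 s ≤ meanLoss ρ (F.prod G) α θ s := by
  simpa using meanLoss_smul_le hρ hF G α θ s le_rfl zero_le_one

lemma integral_lt_integral_of_le {X : Type*} [MeasurableSpace X] {μ : Measure X} {f g : X → ℝ}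
    (hf : Integrable f μ) (hg : Integrable g μ) (hle : ∀ x, f x ≤ g x)
    (h : μ {x | f x < g x} ≠ 0) : ∫ x, f x ∂μ < ∫ x, g x ∂μ := by
  rw [← sub_pos, ← integral_sub hg hf,
    integral_pos_iff_support_of_nonneg (fun x => sub_nonneg.2 (hle x)) (hg.sub hf)]
  exact (pos_iff_ne_zero.2 h).trans_le (measure_mono fun x hx => (sub_pos.2 hx).ne')

/-- The contraction reduces `|α + x'θ|` strictly unless it is `0`, and the regressor law does not
concentrate on that hyperplane. -/
lemma meanLoss_smul_lt (hρ : IsLoss ρ) {u₁ : ℝ} (hu₁ : 0 < u₁) (h1 : ρ u₁ < 1) {F : Measure ℝ}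
    [IsProbabilityMeasure F] (hF : IsErrorLaw F) {G : Measure (Regr p)} [IsProbabilityMeasure G]
    (hG : IsRegressorLaw G) (α : ℝ) {θ : Regr p} (hθ : θ ≠ 0) {s : ℝ} (hs : 0 < s) {r : ℝ}
    (hr0 : 0 ≤ r) (hr1 : r < 1) :
    meanLoss ρ (F.prod G) (r * α) (r • θ) s < meanLoss ρ (F.prod G) α θ s := by
  rw [meanLoss_prod hρ, meanLoss_prod hρ]
  have habs : ∀ x, |r * α + inner ℝ x (r • θ)| = r * |α + inner ℝ x θ| := fun x => by
    rw [inner_smul_right, ← mul_add, abs_mul, abs_of_nonneg hr0]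
  refine integral_lt_integral_of_le (integrable_shiftLoss hρ F G _ _ s)
    (integrable_shiftLoss hρ F G _ _ s) (fun x => shiftLoss_le hρ hF s ?_) fun h0 => ?_
  · rw [habs]
    exact mul_le_of_le_one_left (abs_nonneg _) hr1.le
  · refine (hG θ hθ (-α)).ne (le_antisymm prob_le_one ?_)
    have hcompl : G {x | inner ℝ x θ = -α}ᶜ = 0 := by
      refine measure_mono_null (fun x hx => ?_) h0
      have hx' : 0 < |α + inner ℝ x θ| := abs_pos.2 fun h => hx (by
        show inner ℝ x θ = -α
        linarith)
      refine shiftLoss_lt hρ hu₁ h1 hF hs ?_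
      rw [habs]
      exact mul_lt_of_lt_one_left hx' hr1
    have hms : MeasurableSet {x : Regr p | inner ℝ x θ = -α} :=
      measurableSet_eq_fun (by fun_prop) measurable_const
    rw [(prob_compl_eq_zero_iff hms).1 hcompl]

lemma shiftLoss_lt_of_scale_lt (hρ : IsLoss ρ) {u₁ : ℝ} (hu₁ : 0 < u₁) (h1 : ρ u₁ < 1)
    {F : Measure ℝ} [IsProbabilityMeasure F] (hF : IsErrorLaw F) {s s' : ℝ} (hs : 0 < s)
    (hss : s < s') (a : ℝ) : shiftLoss ρ F s' a < shiftLoss ρ F s a := by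
  have := hF.isOpenPosMeasure
  obtain ⟨u₀, hu₀, hgrow⟩ := hρ.exists_growth_point hu₁ h1
  refine integral_lt_integral_of_le (hρ.integrable_comp (by fun_prop))
    (hρ.integrable_comp (by fun_prop))
    (fun y => hρ.le_of_abs_le (abs_div_le_abs_div hs hss.le)) ?_
  -- These are the errors whose scaled residuals at `s` and `s'` fall on opposite sides of the
  -- growth point; the error law charges every nonempty open set.
  have hopen : IsOpen ({y : ℝ | u₀ * s < |y - a|} ∩ {y : ℝ | |y - a| < u₀ * s'}) :=
    (isOpen_lt continuous_const (by fun_prop)).inter (isOpen_lt (by fun_prop) continuous_const)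
  have hlt : u₀ * s < u₀ * s' := by gcongr
  have hne : ({y : ℝ | u₀ * s < |y - a|} ∩ {y : ℝ | |y - a| < u₀ * s'}).Nonempty := by
    obtain ⟨d, hd1, hd2⟩ := exists_between hlt
    have hd : 0 < d := (mul_pos hu₀ hs).trans hd1
    refine ⟨a + d, ?_⟩
    show u₀ * s < |a + d - a| ∧ |a + d - a| < u₀ * s'
    rw [add_sub_cancel_left, abs_of_pos hd]
    exact ⟨hd1, hd2⟩
  refine ((hopen.measure_pos F hne).trans_le (measure_mono fun y hy => ?_)).ne'
  refine hgrow _ _ ?_ ?_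
  · rw [abs_div, abs_of_pos (hs.trans hss), div_lt_iff₀ (hs.trans hss)]
    exact hy.2
  · rw [abs_div, abs_of_pos hs, lt_div_iff₀ hs]
    exact hy.1

lemma meanLoss_lt_of_scale_lt (hρ : IsLoss ρ) {u₁ : ℝ} (hu₁ : 0 < u₁) (h1 : ρ u₁ < 1)
    {F : Measure ℝ} [IsProbabilityMeasure F] (hF : IsErrorLaw F) (G : Measure (Regr p))
    [IsProbabilityMeasure G] (α : ℝ) (θ : Regr p) {s s' : ℝ} (hs : 0 < s) (hss : s < s') :
    meanLoss ρ (F.prod G) α θ s' < meanLoss ρ (F.prod G) α θ s := by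
  rw [meanLoss_prod hρ, meanLoss_prod hρ]
  have hlt : ∀ x : Regr p, shiftLoss ρ F s' (α + inner ℝ x θ)
      < shiftLoss ρ F s (α + inner ℝ x θ) := fun x =>
    shiftLoss_lt_of_scale_lt hρ hu₁ h1 hF hs hss _
  refine integral_lt_integral_of_le (integrable_shiftLoss hρ F G _ _ _)
    (integrable_shiftLoss hρ F G _ _ _) (fun x => (hlt x).le) ?_
  simp [hlt]

/-- The bound is uniform in `(α, θ)` because the centre has the smallest mean loss at each scale,
and there the mean loss tends to `1` as the scale shrinks. -/
lemma exists_le_scale_of_meanLoss_le (hρ : IsLoss ρ) {F : Measure ℝ} [IsProbabilityMeasure F]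
    (hF : IsErrorLaw F) (G : Measure (Regr p)) [IsProbabilityMeasure G] {κ : ℝ} (hκ : κ < 1) :
    ∃ s₀ > 0, ∀ (α : ℝ) (θ : Regr p) (s : ℝ), 0 < s → meanLoss ρ (F.prod G) α θ s ≤ κ →
      s₀ ≤ s := by
  have hlim : Tendsto (fun s => meanLoss ρ (F.prod G) 0 0 s) (𝓝[>] 0) (𝓝 1) := by
    have : Tendsto (fun s => meanLoss ρ (F.prod G) 0 0 s) (𝓝[>] 0)
        (𝓝 (∫ _, (1 : ℝ) ∂(F.prod G))) := by
      refine tendsto_integral_loss hρ (fun i => measurable_resid _ _ _) ?_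
      filter_upwards [ae_resid_div_notMem hF G (Set.countable_singleton 0) 0 0 one_ne_zero]
        with z hz
      rw [div_one] at hz
      refine hρ.tendsto_one_of_abs ?_
      have hpos : 0 < |z.1 - 0 - inner ℝ z.2 (0 : Regr p)| := abs_pos.2 hz
      refine (tendsto_inv_nhdsGT_zero.const_mul_atTop hpos).congr' ?_
      filter_upwards [self_mem_nhdsWithin] with s hs
      rw [abs_div, abs_of_pos (show (0 : ℝ) < s from hs), div_eq_mul_inv]
    simpa using this
  obtain ⟨s₀, hs₀, hpos⟩ := ((hlim.eventually (lt_mem_nhds hκ)).and self_mem_nhdsWithin).exists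
  refine ⟨s₀, hpos, fun α θ s hs hle => ?_⟩
  by_contra! hlt
  exact absurd ((meanLoss_antitone hρ _ 0 0 hs hpos hlt.le).trans
    ((meanLoss_zero_le hρ hF G α θ s).trans hle)) (not_le.2 hs₀)

/-- With slopes and scales bounded, divergent intercepts make every residual diverge, so the mean
loss would tend to `1 > κ`. -/
lemma exists_abs_intercept_le (hρ : IsLoss ρ) (H : Measure (ℝ × Regr p)) [IsProbabilityMeasure H]
    {κ : ℝ} (hκ : κ < 1) (R S : ℝ) :
    ∃ A, ∀ (α : ℝ) (θ : Regr p) (s : ℝ), ‖θ‖ ≤ R → 0 < s → s ≤ S →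
      meanLoss ρ H α θ s ≤ κ → |α| ≤ A := by
  by_contra! hcon
  choose a t s ht hs hS hle ha using fun n : ℕ => hcon n
  have hlim : Tendsto (fun n => meanLoss ρ H (a n) (t n) (s n)) atTop
      (𝓝 (∫ _, (1 : ℝ) ∂H)) := by
    refine tendsto_integral_loss hρ (fun i => measurable_resid _ _ _)
      (ae_of_all _ fun z => hρ.tendsto_one_of_abs ?_)
    have hSpos : 0 < S := (hs 0).trans_le (hS 0)
    refine tendsto_atTop_mono (f := fun n : ℕ => ((n : ℝ) + -(|z.1| + ‖z.2‖ * R)) / S)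
      (fun n => ?_) ((tendsto_atTop_add_const_right _ _
        tendsto_natCast_atTop_atTop).atTop_div_const hSpos)
    have h1 : |inner ℝ z.2 (t n)| ≤ ‖z.2‖ * R :=
      (abs_real_inner_le_norm _ _).trans (by gcongr; exact ht n)
    have h2 : (n : ℝ) + -(|z.1| + ‖z.2‖ * R) ≤ |z.1 - a n - inner ℝ z.2 (t n)| := by
      have h3 : |a n| ≤ |z.1 - a n - inner ℝ z.2 (t n)| + |z.1| + |inner ℝ z.2 (t n)| := by
        have e : a n = -(z.1 - a n - inner ℝ z.2 (t n)) + z.1 - inner ℝ z.2 (t n) := by ring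
        calc |a n| = |-(z.1 - a n - inner ℝ z.2 (t n)) + z.1 - inner ℝ z.2 (t n)| := by rw [← e]
          _ ≤ |-(z.1 - a n - inner ℝ z.2 (t n)) + z.1| + |inner ℝ z.2 (t n)| := abs_sub _ _
          _ ≤ |-(z.1 - a n - inner ℝ z.2 (t n))| + |z.1| + |inner ℝ z.2 (t n)| := by
            gcongr
            exact abs_add_le _ _
          _ = _ := by rw [abs_neg]
      linarith [ha n]
    rw [abs_div, abs_of_pos (hs n)]
    calc ((n : ℝ) + -(|z.1| + ‖z.2‖ * R)) / S ≤ |z.1 - a n - inner ℝ z.2 (t n)| / S := by gcongr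
      _ ≤ _ := by
        have := hs n
        have := hS n
        gcongr
  simp only [integral_const, probReal_univ, one_smul] at hlim
  exact absurd (le_of_tendsto' hlim hle) (not_le.2 hκ)

lemma exists_subseq_tendsto (hρ : IsLoss ρ) {F : Measure ℝ} [IsProbabilityMeasure F]
    (hF : IsErrorLaw F) (G : Measure (Regr p)) [IsProbabilityMeasure G] {κ R S : ℝ} (hκ : κ < 1)
    {a s : ℕ → ℝ} {t : ℕ → Regr p} (ht : ∀ n, ‖t n‖ ≤ R) (hs : ∀ n, 0 < s n)
    (hS : ∀ n, s n ≤ S) (hle : ∀ n, meanLoss ρ (F.prod G) (a n) (t n) (s n) ≤ κ) :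
    ∃ (α : ℝ) (θ : Regr p) (σ : ℝ) (φ : ℕ → ℕ), 0 < σ ∧ StrictMono φ ∧
      Tendsto (a ∘ φ) atTop (𝓝 α) ∧ Tendsto (t ∘ φ) atTop (𝓝 θ) ∧
      Tendsto (s ∘ φ) atTop (𝓝 σ) := by
  obtain ⟨s₀, hs₀, hlow⟩ := exists_le_scale_of_meanLoss_le hρ hF G hκ
  obtain ⟨A, hA⟩ := exists_abs_intercept_le hρ (F.prod G) hκ R S
  have hK : IsCompact (Set.Icc (-A) A ×ˢ Metric.closedBall (0 : Regr p) R ×ˢ Set.Icc s₀ S) :=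
    isCompact_Icc.prod ((isCompact_closedBall _ _).prod isCompact_Icc)
  obtain ⟨⟨α, θ, σ⟩, hmem, φ, hφ, hlim⟩ := hK.tendsto_subseq (x := fun n => (a n, t n, s n))
    fun n => ⟨abs_le.1 (hA _ _ _ (ht n) (hs n) (hS n) (hle n)),
      mem_closedBall_zero_iff.2 (ht n), hlow _ _ _ (hs n) (hle n), hS n⟩
  refine ⟨α, θ, σ, φ, hs₀.trans_le hmem.2.2.1, hφ, ?_, ?_, ?_⟩
  · exact (continuous_fst.tendsto _).comp hlim
  · exact ((continuous_fst.comp continuous_snd).tendsto _).comp hlim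
  · exact ((continuous_snd.comp continuous_snd).tendsto _).comp hlim

/-! ### Admissibility -/

lemma meanLoss_eq_one (hρ : IsLoss ρ) (h1 : ∀ u, 0 < u → 1 ≤ ρ u) {F : Measure ℝ}
    [IsProbabilityMeasure F] (hF : IsErrorLaw F) (G : Measure (Regr p)) [IsProbabilityMeasure G]
    (α : ℝ) (θ : Regr p) {s : ℝ} (hs : 0 < s) : meanLoss ρ (F.prod G) α θ s = 1 := by
  have : meanLoss ρ (F.prod G) α θ s = ∫ _, (1 : ℝ) ∂(F.prod G) := by
    refine integral_congr_ae ?_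
    filter_upwards [ae_resid_div_notMem hF G (Set.countable_singleton 0) α θ hs.ne'] with z hz
    rw [← hρ.map_abs]
    exact le_antisymm (hρ.le_one _) (h1 _ (abs_pos.2 hz))
  simpa using this

lemma exists_loss_lt_one (hρ : IsLoss ρ) {F : Measure ℝ} [IsProbabilityMeasure F]
    (hF : IsErrorLaw F) (G : Measure (Regr p)) [IsProbabilityMeasure G] {α s κ : ℝ}
    {θ : Regr p} (hs : 0 < s) (hκ : κ < 1) (hle : meanLoss ρ (F.prod G) α θ s ≤ κ) :
    ∃ u, 0 < u ∧ ρ u < 1 := by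
  by_contra! h1
  rw [meanLoss_eq_one hρ h1 hF G α θ hs] at hle
  linarith

lemma tendsto_meanLoss_atTop (hρ : IsLoss ρ) {F : Measure ℝ} [IsProbabilityMeasure F]
    (hF : IsErrorLaw F) (G : Measure (Regr p)) [IsProbabilityMeasure G] {d : ℝ}
    (hd : Tendsto ρ (𝓝[>] 0) (𝓝 d)) (α : ℝ) (θ : Regr p) :
    Tendsto (meanLoss ρ (F.prod G) α θ) atTop (𝓝 d) := by
  have : Tendsto (meanLoss ρ (F.prod G) α θ) atTop (𝓝 (∫ _, d ∂(F.prod G))) := by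
    refine tendsto_integral_loss hρ (fun i => measurable_resid _ _ _) ?_
    filter_upwards [ae_resid_div_notMem hF G (Set.countable_singleton 0) α θ one_ne_zero]
      with z hz
    rw [div_one] at hz
    have hpos : 0 < |z.1 - α - inner ℝ z.2 θ| := abs_pos.2 hz
    have hlim : Tendsto (fun s : ℝ => |(z.1 - α - inner ℝ z.2 θ) / s|) atTop (𝓝[>] 0) := by
      refine tendsto_nhdsWithin_iff.2 ⟨?_, ?_⟩
      · have := (tendsto_const_nhds (x := z.1 - α - inner ℝ z.2 θ)).div_atTop
          (tendsto_id (α := ℝ) (x := atTop))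
        simpa using this.abs
      · filter_upwards [eventually_gt_atTop 0] with s hs
        exact abs_pos.2 (div_ne_zero hz hs.ne')
    simpa only [Function.comp_def, hρ.map_abs] using hd.comp hlim
  simpa using this

/-- Whether a level of the mean loss can be reached does not depend on the parameters. -/
lemma exists_meanLoss_le (hρ : IsLoss ρ) {F : Measure ℝ} [IsProbabilityMeasure F]
    (hF : IsErrorLaw F) (G : Measure (Regr p)) [IsProbabilityMeasure G] {α s κ : ℝ}
    {θ : Regr p} (hs : 0 < s) (hle : meanLoss ρ (F.prod G) α θ s ≤ κ) (α' : ℝ) (θ' : Regr p) :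
    ∃ s' > 0, meanLoss ρ (F.prod G) α' θ' s' ≤ κ := by
  by_cases h1 : ∀ u, 0 < u → 1 ≤ ρ u
  · refine ⟨1, one_pos, ?_⟩
    rwa [meanLoss_eq_one hρ h1 hF G α' θ' one_pos, ← meanLoss_eq_one hρ h1 hF G α θ hs]
  · push Not at h1
    obtain ⟨u₁, hu₁, h1⟩ := h1
    have hmono : MonotoneOn ρ (Set.Ioi 0) := hρ.mono.mono Set.Ioi_subset_Ici_self
    have hbdd : BddBelow (ρ '' Set.Ioi 0) := ⟨0, by rintro _ ⟨u, -, rfl⟩; exact hρ.nonneg u⟩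
    have hd := hmono.tendsto_nhdsGT hbdd
    have hlim := tendsto_meanLoss_atTop hρ hF G hd
    -- Enlarging the scale makes the inequality strict. The right limit of `ρ` at `0`, which is the
    -- limiting mean loss at any parameters, is therefore strictly below `κ`.
    have hlt := meanLoss_lt_of_scale_lt hρ hu₁ h1 hF G α θ hs (lt_add_one s)
    have hge : sInf (ρ '' Set.Ioi 0) ≤ meanLoss ρ (F.prod G) α θ (s + 1) := by
      refine le_of_tendsto (hlim α θ) ?_
      filter_upwards [eventually_ge_atTop (s + 1)] with s' hs'
      exact meanLoss_antitone hρ _ α θ (show (0 : ℝ) < s + 1 by linarith)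
        (show (0 : ℝ) < s' by linarith) hs'
    obtain ⟨s', hs', hpos⟩ := (((hlim α' θ').eventually
      (gt_mem_nhds (hge.trans_lt (hlt.trans_le hle)))).and (eventually_gt_atTop 0)).exists
    exact ⟨s', hpos, hs'.le⟩

/-! ### Existence of minimizers -/

lemma le_div_of_one_sub_mul_le {ε b x : ℝ} (hε : ε < 1 - b) (hb0 : 0 < b)
    (h : (1 - ε) * x ≤ b) : x ≤ b / (1 - ε) := by
  rw [le_div_iff₀ (by linarith)]
  linarith

lemma div_one_sub_lt_one {ε b : ℝ} (hε : ε < 1 - b) (hb0 : 0 < b) : b / (1 - ε) < 1 := by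
  rw [div_lt_one (by linarith)]
  linarith

/-- Minimization of `c e(α, θ, s) + log s` under `e(α, θ, s) ≤ b` and `θ ∈ Θ`, for an `e` that
dominates the mean loss of the central part and is lower semicontinuous up to an increase of the
scale: the limit of a minimizing sequence is optimal up to an increase of the scale. -/
lemma exists_minimizing_triple (hρ : IsLoss ρ) {c b ε R : ℝ} (hc : 0 < c) (hb0 : 0 < b)
    (hε : ε < 1 - b) {F : Measure ℝ} [IsProbabilityMeasure F] (hF : IsErrorLaw F)
    (G : Measure (Regr p)) [IsProbabilityMeasure G] {Θ : Set (Regr p)} (hΘ : IsClosed Θ)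
    (hR : ∀ θ ∈ Θ, ‖θ‖ ≤ R) {e : ℝ → Regr p → ℝ → ℝ}
    (hlow : ∀ α θ s, (1 - ε) * meanLoss ρ (F.prod G) α θ s ≤ e α θ s)
    (hlsc : ∀ (a s q : ℕ → ℝ) (t : ℕ → Regr p) (α σ σ' Q : ℝ) (θ : Regr p),
      Tendsto a atTop (𝓝 α) → Tendsto t atTop (𝓝 θ) → Tendsto s atTop (𝓝 σ) → 0 < σ → σ < σ' →
      (∀ n, e (a n) (t n) (s n) ≤ q n) → Tendsto q atTop (𝓝 Q) → e α θ σ' ≤ Q)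
    (hne : ∃ α, ∃ θ ∈ Θ, ∃ s, 0 < s ∧ e α θ s ≤ b) :
    ∃ (V α : ℝ) (θ : Regr p) (σ : ℝ), θ ∈ Θ ∧ 0 < σ ∧
      (∀ σ' > σ, e α θ σ' ≤ b ∧ c * e α θ σ' ≤ V - Real.log σ) ∧
      ∀ α', ∀ θ' ∈ Θ, ∀ s', 0 < s' → e α' θ' s' ≤ b → V ≤ c * e α' θ' s' + Real.log s' := by
  have hκ := div_one_sub_lt_one hε hb0
  obtain ⟨s₀, hs₀, hs₀le⟩ := exists_le_scale_of_meanLoss_le hρ hF G hκ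
  have hbound : ∀ α θ s, e α θ s ≤ b → meanLoss ρ (F.prod G) α θ s ≤ b / (1 - ε) :=
    fun α θ s h => le_div_of_one_sub_mul_le hε hb0 ((hlow α θ s).trans h)
  have hnonneg : ∀ α θ s, 0 ≤ e α θ s := fun α θ s =>
    (mul_nonneg (by linarith) (meanLoss_nonneg hρ _ _ _ _)).trans (hlow α θ s)
  set S : Set ℝ := {v | ∃ α, ∃ θ ∈ Θ, ∃ s, 0 < s ∧ e α θ s ≤ b ∧ v = c * e α θ s + Real.log s}
    with hS
  have hSne : S.Nonempty := by
    obtain ⟨α, θ, hθ, s, hs, he⟩ := hne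
    exact ⟨_, α, θ, hθ, s, hs, he, rfl⟩
  have hSb : BddBelow S := by
    refine ⟨Real.log s₀, ?_⟩
    rintro _ ⟨α, θ, hθ, s, hs, he, rfl⟩
    have h1 := Real.log_le_log hs₀ (hs₀le α θ s hs (hbound α θ s he))
    have h2 := mul_nonneg hc.le (hnonneg α θ s)
    linarith
  obtain ⟨v, hanti, hlim, hmem⟩ := exists_seq_tendsto_sInf hSne hSb
  choose a t ht s hs he hv using hmem
  -- The loss term is nonnegative and the values decrease, so `log (s n) ≤ v 0`.
  have hsle : ∀ n, s n ≤ Real.exp (v 0) := fun n => by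
    rw [← Real.log_le_iff_le_exp (hs n)]
    have h1 := hanti (Nat.zero_le n)
    have h2 := mul_nonneg hc.le (hnonneg (a n) (t n) (s n))
    linarith [hv n]
  obtain ⟨α, θ, σ, φ, hσ, hφ, hα, hθ, hσl⟩ := exists_subseq_tendsto hρ hF G hκ
    (fun n => hR _ (ht n)) hs hsle (fun n => hbound _ _ _ (he n))
  refine ⟨sInf S, α, θ, σ, hΘ.mem_of_tendsto hθ (Eventually.of_forall fun n => ht _), hσ,
    fun σ' hσ' => ⟨?_, ?_⟩, fun α' θ' hθ' s' hs' he' => csInf_le hSb ⟨α', θ', hθ', s', hs', he', rfl⟩⟩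
  · exact hlsc _ _ (fun _ => b) _ _ _ _ _ _ hα hθ hσl hσ hσ' (fun n => he _) tendsto_const_nhds
  · rw [mul_comm, ← le_div_iff₀ hc]
    -- Semicontinuity is applied to the loss alone, solved from the objective value, so the
    -- logarithm is taken at the limit scale `σ` and not at `σ'`.
    refine hlsc _ _ (fun n => (v (φ n) - Real.log (s (φ n))) / c) _ _ _ _ _ _ hα hθ hσl hσ hσ'
      (fun n => ?_) ?_
    · rw [le_div_iff₀ hc, hv]
      simp only [Function.comp_apply]
      linarith
    · exact ((hlim.comp hφ.tendsto_atTop).sub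
        ((Real.continuousAt_log hσ.ne').tendsto.comp hσl)).div_const c

/-! ### The function `m`: attainment, strict monotonicity and semicontinuity -/

lemma cmM_eq (hρ : IsLoss ρ) {c b : ℝ} (hc : 0 < c) (H : Measure (ℝ × Regr p))
    [IsProbabilityMeasure H] {ε : ℝ} (hε0 : 0 ≤ ε) (hε1 : ε ≤ 1) (t : ℝ) :
    cmM ρ c b H ε t = ⨅ (θ : Regr p) (_ : ‖θ‖ = t) (α : ℝ),
      scaleProfile c b (fun s => (1 - ε) * meanLoss ρ H α θ s) := by
  simp only [cmM, cmJ_mix_zero hρ hc H hε0 hε1]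

lemma cmM_le_scaleProfile (hρ : IsLoss ρ) {c b : ℝ} (hc : 0 < c) (H : Measure (ℝ × Regr p))
    [IsProbabilityMeasure H] {ε : ℝ} (hε0 : 0 ≤ ε) (hε1 : ε ≤ 1) (α : ℝ) (θ : Regr p) :
    cmM ρ c b H ε ‖θ‖ ≤ scaleProfile c b (fun s => (1 - ε) * meanLoss ρ H α θ s) := by
  rw [cmM_eq hρ hc H hε0 hε1]
  exact iInf_le_of_le θ (iInf_le_of_le rfl (iInf_le _ α))

lemma cmM_le (hρ : IsLoss ρ) {c b : ℝ} (hc : 0 < c) (H : Measure (ℝ × Regr p))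
    [IsProbabilityMeasure H] {ε : ℝ} (hε0 : 0 ≤ ε) (hε1 : ε ≤ 1) {α : ℝ} {θ : Regr p} {t s : ℝ}
    (ht : ‖θ‖ = t) (hs : 0 < s) (hle : (1 - ε) * meanLoss ρ H α θ s ≤ b) :
    cmM ρ c b H ε t ≤ ((c * ((1 - ε) * meanLoss ρ H α θ s) + Real.log s : ℝ) : EReal) := by
  subst ht
  exact (cmM_le_scaleProfile hρ hc H hε0 hε1 α θ).trans (scaleProfile_le hs hle)

lemma le_cmM_iff (hρ : IsLoss ρ) {c b : ℝ} (hc : 0 < c) (H : Measure (ℝ × Regr p))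
    [IsProbabilityMeasure H] {ε : ℝ} (hε0 : 0 ≤ ε) (hε1 : ε ≤ 1) {t : ℝ} {x : EReal} :
    x ≤ cmM ρ c b H ε t ↔ ∀ (α : ℝ) (θ : Regr p) (s : ℝ), ‖θ‖ = t → 0 < s →
      (1 - ε) * meanLoss ρ H α θ s ≤ b →
      x ≤ ((c * ((1 - ε) * meanLoss ρ H α θ s) + Real.log s : ℝ) : EReal) := by
  rw [cmM_eq hρ hc H hε0 hε1]
  simp only [le_iInf_iff, le_scaleProfile_iff]
  exact ⟨fun h α θ s ht => h θ ht α s, fun h θ ht α s => h α θ s ht⟩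

lemma exists_norm_eq_regr (hp : 0 < p) {t : ℝ} (ht : 0 ≤ t) : ∃ θ : Regr p, ‖θ‖ = t := by
  have : Nonempty (Fin p) := ⟨⟨0, hp⟩⟩
  exact exists_norm_eq (Regr p) ht

lemma cmM_eq_bot (hp : 0 < p) (hρ : IsLoss ρ) {c b : ℝ} (hc : 0 < c) (H : Measure (ℝ × Regr p))
    [IsProbabilityMeasure H] {ε : ℝ} (hε0 : 0 ≤ ε) (hε1 : ε ≤ 1) (hε : 1 - b ≤ ε) {t : ℝ}
    (ht : 0 ≤ t) : cmM ρ c b H ε t = ⊥ := by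
  obtain ⟨θ, rfl⟩ := exists_norm_eq_regr hp ht
  refine eq_bot_iff.2 ((cmM_le_scaleProfile hρ hc H hε0 hε1 0 θ).trans
    (scaleProfile_eq_bot hc fun s hs => ?_).le)
  have := mul_le_mul_of_nonneg_left (meanLoss_le_one hρ H 0 θ s) (by linarith : 0 ≤ 1 - ε)
  linarith

/-- Below the breakdown point, the infimum `m(t)` is attained. -/
lemma exists_cmM_eq (hp : 0 < p) (hρ : IsLoss ρ) {c b ε : ℝ} (hc : 0 < c) (hb0 : 0 < b)
    (hε0 : 0 ≤ ε) (hε : ε < 1 - b) {F : Measure ℝ} [IsProbabilityMeasure F] (hF : IsErrorLaw F)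
    (G : Measure (Regr p)) [IsProbabilityMeasure G] {α₀ s₀ : ℝ} {θ₀ : Regr p} (hs₀ : 0 < s₀)
    (h₀ : (1 - ε) * meanLoss ρ (F.prod G) α₀ θ₀ s₀ ≤ b) {t : ℝ} (ht : 0 ≤ t) :
    ∃ (α : ℝ) (θ : Regr p) (σ : ℝ), ‖θ‖ = t ∧ 0 < σ ∧
      (1 - ε) * meanLoss ρ (F.prod G) α θ σ ≤ b ∧ cmM ρ c b (F.prod G) ε t
        = ((c * ((1 - ε) * meanLoss ρ (F.prod G) α θ σ) + Real.log σ : ℝ) : EReal) := by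
  have hpos : 0 < 1 - ε := by linarith
  obtain ⟨θ₁, hθ₁⟩ := exists_norm_eq_regr hp ht
  obtain ⟨s₁, hs₁, hle⟩ := exists_meanLoss_le hρ hF G hs₀
    (le_div_of_one_sub_mul_le hε hb0 h₀) 0 θ₁
  obtain ⟨V, α, θ, σ, hθ, hσ, hup, hmin⟩ := exists_minimizing_triple hρ hc hb0 hε hF G
    (Θ := {θ | ‖θ‖ = t}) (isClosed_eq continuous_norm continuous_const)
    (fun θ hθ => le_of_eq hθ) (e := fun α θ s => (1 - ε) * meanLoss ρ (F.prod G) α θ s)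
    (fun _ _ _ => le_rfl) (fun a s q t α σ σ' Q θ ha ht hs hσ hσ' hle hq => by
      rw [mul_comm, ← le_div_iff₀ hpos]
      refine meanLoss_le_of_tendsto hρ _ ha ht hs hσ hσ' (q := fun n => q n / (1 - ε))
        (fun n => ?_) (hq.div_const _)
      rw [le_div_iff₀ hpos, mul_comm]
      exact hle n)
    ⟨0, θ₁, hθ₁, s₁, hs₁, by rwa [le_div_iff₀ hpos, mul_comm] at hle⟩
  -- Under the central model the mean loss is continuous in the scale, so what holds for all `σ' >
  -- σ` passes to `σ` itself.
  have hcont : Tendsto (fun s => (1 - ε) * meanLoss ρ (F.prod G) α θ s) (𝓝[>] σ)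
      (𝓝 ((1 - ε) * meanLoss ρ (F.prod G) α θ σ)) :=
    (tendsto_meanLoss hρ hF G tendsto_const_nhds tendsto_const_nhds
      (tendsto_id.mono_left nhdsWithin_le_nhds) hσ).const_mul _
  have h1 : (1 - ε) * meanLoss ρ (F.prod G) α θ σ ≤ b := by
    refine le_of_tendsto hcont ?_
    filter_upwards [self_mem_nhdsWithin] with s hs using (hup s hs).1
  have h2 : c * ((1 - ε) * meanLoss ρ (F.prod G) α θ σ) ≤ V - Real.log σ := by
    refine le_of_tendsto (hcont.const_mul c) ?_
    filter_upwards [self_mem_nhdsWithin] with s hs using (hup s hs).2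
  refine ⟨α, θ, σ, hθ, hσ, h1, le_antisymm
    (cmM_le hρ hc _ hε0 (by linarith) hθ hσ h1)
    ((le_cmM_iff hρ hc _ hε0 (by linarith)).2 fun α' θ' s' hθ' hs' hle' => ?_)⟩
  rw [EReal.coe_le_coe_iff]
  have := hmin α' θ' hθ' s' hs' hle'
  linarith

/-- Contracting a minimizer at `t₂` by the factor `t₁ / t₂` keeps the scale admissible and strictly
lowers the objective. -/
lemma strictMonoOn_cmM (hp : 0 < p) (hρ : IsLoss ρ) {c b ε : ℝ} (hc : 0 < c) (hb0 : 0 < b)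
    (hε0 : 0 ≤ ε) (hε : ε < 1 - b) {F : Measure ℝ} [IsProbabilityMeasure F] (hF : IsErrorLaw F)
    {G : Measure (Regr p)} [IsProbabilityMeasure G] (hG : IsRegressorLaw G) {α₀ s₀ : ℝ}
    {θ₀ : Regr p} (hs₀ : 0 < s₀) (h₀ : (1 - ε) * meanLoss ρ (F.prod G) α₀ θ₀ s₀ ≤ b) :
    StrictMonoOn (cmM ρ c b (F.prod G) ε) (Set.Ici 0) := by
  intro t₁ ht₁ t₂ ht₂ hlt
  rw [Set.mem_Ici] at ht₁
  have ht₂pos : 0 < t₂ := ht₁.trans_lt hlt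
  have hpos : 0 < 1 - ε := by linarith
  obtain ⟨u₁, hu₁, h1⟩ := exists_loss_lt_one hρ hF G hs₀ (div_one_sub_lt_one hε hb0)
    (le_div_of_one_sub_mul_le hε hb0 h₀)
  obtain ⟨α, θ, σ, hθ, hσ, hle, heq⟩ := exists_cmM_eq hp hρ hc hb0 hε0 hε hF G hs₀ h₀ ht₂pos.le
  have hθ0 : θ ≠ 0 := norm_ne_zero_iff.1 (hθ ▸ ht₂pos.ne')
  have key := mul_lt_mul_of_pos_left (meanLoss_smul_lt hρ hu₁ h1 hF hG α hθ0 hσ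
    (div_nonneg ht₁ ht₂pos.le) ((div_lt_one ht₂pos).2 hlt)) hpos
  have hnorm : ‖(t₁ / t₂) • θ‖ = t₁ := by
    rw [norm_smul, hθ, Real.norm_of_nonneg (div_nonneg ht₁ ht₂pos.le),
      div_mul_cancel₀ _ ht₂pos.ne']
  refine (cmM_le hρ hc _ hε0 (by linarith) hnorm hσ (key.le.trans hle)).trans_lt ?_
  rw [heq, EReal.coe_lt_coe_iff]
  gcongr

/-- Right upper semicontinuity of `m`. -/
lemma exists_gt_cmM_le (hp : 0 < p) (hρ : IsLoss ρ) {c b ε : ℝ} (hc : 0 < c) (hb0 : 0 < b)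
    (hε0 : 0 ≤ ε) (hε : ε < 1 - b) {F : Measure ℝ} [IsProbabilityMeasure F] (hF : IsErrorLaw F)
    (G : Measure (Regr p)) [IsProbabilityMeasure G] {α₀ s₀ : ℝ} {θ₀ : Regr p} (hs₀ : 0 < s₀)
    (h₀ : (1 - ε) * meanLoss ρ (F.prod G) α₀ θ₀ s₀ ≤ b) {t : ℝ} (ht : 0 ≤ t) {r : ℝ}
    (hr : cmM ρ c b (F.prod G) ε t < r) : ∃ t' > t, cmM ρ c b (F.prod G) ε t' ≤ r := by
  have hpos : 0 < 1 - ε := by linarith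
  obtain ⟨u₁, hu₁, h1⟩ := exists_loss_lt_one hρ hF G hs₀ (div_one_sub_lt_one hε hb0)
    (le_div_of_one_sub_mul_le hε hb0 h₀)
  obtain ⟨α, θ, σ, hθ, hσ, hle, heq⟩ := exists_cmM_eq hp hρ hc hb0 hε0 hε hF G hs₀ h₀ ht
  rw [heq, EReal.coe_lt_coe_iff] at hr
  have hlim : Tendsto (fun s => c * ((1 - ε) * meanLoss ρ (F.prod G) α θ s) + Real.log s)
      (𝓝[>] σ) (𝓝 (c * ((1 - ε) * meanLoss ρ (F.prod G) α θ σ) + Real.log σ)) :=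
    (((tendsto_meanLoss hρ hF G tendsto_const_nhds tendsto_const_nhds
      (tendsto_id.mono_left nhdsWithin_le_nhds) hσ).const_mul _).const_mul _).add
      ((Real.continuousAt_log hσ.ne').tendsto.mono_left nhdsWithin_le_nhds)
  -- A slightly larger scale keeps the value below `r` and makes the constraint strict, which leaves
  -- room to lengthen the slope.
  obtain ⟨σ', hσ'r, hσ'⟩ :=
    ((hlim.eventually (gt_mem_nhds hr)).and self_mem_nhdsWithin).exists
  have hσ'pos : 0 < σ' := hσ.trans hσ'
  have hlt : (1 - ε) * meanLoss ρ (F.prod G) α θ σ' < b :=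
    (mul_lt_mul_of_pos_left (meanLoss_lt_of_scale_lt hρ hu₁ h1 hF G α θ hσ hσ') hpos).trans_le hle
  obtain ⟨e, he1, he⟩ : ∃ e : Regr p, ‖e‖ = 1 ∧ θ = t • e := by
    rcases ht.eq_or_lt with h0 | h0
    · obtain ⟨e, he⟩ := exists_norm_eq_regr hp zero_le_one
      exact ⟨e, he, by rw [← h0, zero_smul, ← norm_eq_zero, hθ, h0]⟩
    · refine ⟨t⁻¹ • θ, ?_, by rw [smul_inv_smul₀ h0.ne']⟩
      rw [norm_smul, hθ, Real.norm_of_nonneg (inv_nonneg.2 ht), inv_mul_cancel₀ h0.ne']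
  have hml : Tendsto (fun t' : ℝ => (1 - ε) * meanLoss ρ (F.prod G) α (t' • e) σ') (𝓝[>] t)
      (𝓝 ((1 - ε) * meanLoss ρ (F.prod G) α θ σ')) := by
    refine (tendsto_meanLoss hρ hF G tendsto_const_nhds ?_ tendsto_const_nhds hσ'pos).const_mul _
    rw [he]
    exact (tendsto_id.mono_left nhdsWithin_le_nhds).smul_const e
  obtain ⟨t', ⟨h2, h3⟩, h4⟩ := (((hml.eventually (gt_mem_nhds hlt)).and
    (((hml.const_mul c).add_const (Real.log σ')).eventually (gt_mem_nhds hσ'r))).and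
    self_mem_nhdsWithin).exists
  have h4' : t < t' := h4
  refine ⟨t', h4, (cmM_le hρ hc _ hε0 (by linarith) ?_ hσ'pos h2.le).trans
    (EReal.coe_le_coe_iff.2 h3.le)⟩
  rw [norm_smul, he1, Real.norm_of_nonneg (ht.trans h4'.le), mul_one]

/-- Left lower semicontinuity of `m`. -/
lemma cmM_le_of_forall_lt (hp : 0 < p) (hρ : IsLoss ρ) {c b ε : ℝ} (hc : 0 < c) (hb0 : 0 < b)
    (hε0 : 0 ≤ ε) (hε : ε < 1 - b) {F : Measure ℝ} [IsProbabilityMeasure F] (hF : IsErrorLaw F)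
    (G : Measure (Regr p)) [IsProbabilityMeasure G] {α₀ s₀ : ℝ} {θ₀ : Regr p} (hs₀ : 0 < s₀)
    (h₀ : (1 - ε) * meanLoss ρ (F.prod G) α₀ θ₀ s₀ ≤ b) {t : ℝ} (ht : 0 < t) {r : ℝ}
    (hr : ∀ t', 0 ≤ t' → t' < t → cmM ρ c b (F.prod G) ε t' ≤ r) :
    cmM ρ c b (F.prod G) ε t ≤ r := by
  have hpos : 0 < 1 - ε := by linarith
  -- Minimizers at norms increasing to `t` have a limit point of norm `t`, whose objective value is
  -- still at most `r`.
  obtain ⟨τ, -, hτ, hτlim⟩ := exists_seq_strictMono_tendsto' ht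
  choose a θ s hθ hs hle heq using fun n =>
    exists_cmM_eq hp hρ hc hb0 hε0 hε hF G hs₀ h₀ (hτ n).1.le
  have hval : ∀ n, c * ((1 - ε) * meanLoss ρ (F.prod G) (a n) (θ n) (s n)) + Real.log (s n)
      ≤ r := fun n => by
    have := hr (τ n) (hτ n).1.le (hτ n).2
    rwa [heq, EReal.coe_le_coe_iff] at this
  have hsle : ∀ n, s n ≤ Real.exp r := fun n => by
    rw [← Real.log_le_iff_le_exp (hs n)]
    have := mul_nonneg hc.le (mul_nonneg hpos.le
      (meanLoss_nonneg hρ (F.prod G) (a n) (θ n) (s n)))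
    linarith [hval n]
  obtain ⟨α, θ', σ, φ, hσ, hφ, hα, hθ', hσl⟩ := exists_subseq_tendsto hρ hF G
    (div_one_sub_lt_one hε hb0) (fun n => (hθ n).trans_le (hτ n).2.le) hs hsle
    (fun n => le_div_of_one_sub_mul_le hε hb0 (hle n))
  have hml := (tendsto_meanLoss hρ hF G hα hθ' hσl hσ).const_mul (1 - ε)
  have hnorm : ‖θ'‖ = t := by
    refine tendsto_nhds_unique hθ'.norm ?_
    simpa only [Function.comp_def, hθ] using hτlim.comp hφ.tendsto_atTop
  refine (cmM_le hρ hc _ hε0 (by linarith) hnorm hσ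
    (le_of_tendsto' hml fun n => hle _)).trans (EReal.coe_le_coe_iff.2 ?_)
  exact le_of_tendsto' ((hml.const_mul c).add
    ((Real.continuousAt_log hσ.ne').tendsto.comp hσl)) fun n => hval _

/-! ### The value `r` and solutions at contaminated laws -/

lemma cmProfile_mix (hρ : IsLoss ρ) (c b : ℝ) (H K : Measure (ℝ × Regr p))
    [IsProbabilityMeasure H] [IsProbabilityMeasure K] {ε : ℝ} (hε0 : 0 ≤ ε) (hε1 : ε ≤ 1)
    (α : ℝ) (θ : Regr p) :
    cmProfile ρ c b (mix ε H K) α θ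
      = scaleProfile c b fun s => (1 - ε) * meanLoss ρ H α θ s + ε * meanLoss ρ K α θ s :=
  scaleProfile_congr fun s _ => meanLoss_mix hρ H K hε0 hε1 α θ s

lemma cmM_le_cmProfile_mix (hρ : IsLoss ρ) {c b : ℝ} (hc : 0 < c) (H K : Measure (ℝ × Regr p))
    [IsProbabilityMeasure H] [IsProbabilityMeasure K] {ε : ℝ} (hε0 : 0 ≤ ε) (hε1 : ε ≤ 1)
    (α : ℝ) (θ : Regr p) : cmM ρ c b H ε ‖θ‖ ≤ cmProfile ρ c b (mix ε H K) α θ := by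
  rw [cmProfile_mix hρ c b H K hε0 hε1]
  exact (cmM_le_scaleProfile hρ hc H hε0 hε1 α θ).trans (scaleProfile_mono hc fun s _ =>
    le_add_of_nonneg_right (mul_nonneg hε0 (meanLoss_nonneg hρ K α θ s)))

lemma cmProfile_mix_le_cmR (hρ : IsLoss ρ) {c b : ℝ} (hc : 0 < c) (H K : Measure (ℝ × Regr p))
    [IsProbabilityMeasure H] [IsProbabilityMeasure K] {ε : ℝ} (hε0 : 0 ≤ ε) (hε1 : ε ≤ 1) :
    cmProfile ρ c b (mix ε H K) 0 0 ≤ cmR ρ c b H ε := by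
  rw [cmProfile_mix hρ c b H K hε0 hε1, cmR_eq hρ hc H hε0 hε1]
  exact scaleProfile_mono hc fun s _ => add_le_add_right
    (mul_le_of_le_one_right hε0 (meanLoss_le_one hρ K 0 0 s)) _

lemma cmM_zero_le_cmR (hρ : IsLoss ρ) {c b : ℝ} (hc : 0 < c) (H : Measure (ℝ × Regr p))
    [IsProbabilityMeasure H] {ε : ℝ} (hε0 : 0 ≤ ε) (hε1 : ε ≤ 1) :
    cmM ρ c b H ε 0 ≤ cmR ρ c b H ε := by
  have := (cmM_le_cmProfile_mix hρ hc H H hε0 hε1 0 0).trans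
    (cmProfile_mix_le_cmR (b := b) hρ hc H H hε0 hε1)
  rwa [norm_zero] at this

lemma exists_admissible_of_cmR_ne_top (hρ : IsLoss ρ) {c b : ℝ} (hc : 0 < c)
    (H : Measure (ℝ × Regr p)) [IsProbabilityMeasure H] {ε : ℝ} (hε0 : 0 ≤ ε) (hε1 : ε ≤ 1)
    (hr : cmR ρ c b H ε ≠ ⊤) : ∃ s > 0, (1 - ε) * meanLoss ρ H 0 0 s ≤ b := by
  rw [cmR_eq hρ hc H hε0 hε1, ← lt_top_iff_ne_top] at hr
  obtain ⟨s, hs, hle, -⟩ := scaleProfile_lt_iff.1 hr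
  exact ⟨s, hs, by linarith⟩

lemma cmR_ne_top (hρ : IsLoss ρ) {c b ε : ℝ} (hc : 0 < c) (hε0 : 0 ≤ ε) (hε1 : ε ≤ 1)
    {F : Measure ℝ} [IsProbabilityMeasure F] (hF : IsErrorLaw F) (G : Measure (Regr p))
    [IsProbabilityMeasure G] (h0 : ContinuousAt ρ 0) (hε : ε < b) :
    cmR ρ c b (F.prod G) ε ≠ ⊤ := by
  have hd : Tendsto ρ (𝓝[>] 0) (𝓝 0) := by
    have := h0.tendsto.mono_left (nhdsWithin_le_nhds (s := Set.Ioi 0))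
    rwa [hρ.map_zero] at this
  have hlim := ((tendsto_meanLoss_atTop hρ hF G hd 0 0).const_mul (1 - ε)).add_const ε
  rw [mul_zero, zero_add] at hlim
  obtain ⟨s, hs, hpos⟩ :=
    ((hlim.eventually (gt_mem_nhds hε)).and (eventually_gt_atTop 0)).exists
  rw [cmR_eq hρ hc _ hε0 hε1]
  exact ((scaleProfile_le hpos hs.le).trans_lt (EReal.coe_lt_top _)).ne

/-- Beyond radius `t` the profile is at least `m(t) > r`, hence worse than at the centre, so
minimizing over the closed ball is enough. -/
lemma exists_isCMSlope (hp : 0 < p) (hρ : IsLoss ρ) {c b ε : ℝ} (hc : 0 < c) (hb0 : 0 < b)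
    (hε0 : 0 ≤ ε) (hε : ε < 1 - b) {F : Measure ℝ} [IsProbabilityMeasure F] (hF : IsErrorLaw F)
    {G : Measure (Regr p)} [IsProbabilityMeasure G] (hG : IsRegressorLaw G)
    (K : Measure (ℝ × Regr p)) [IsProbabilityMeasure K] {t : ℝ} (ht : 0 ≤ t)
    (hr : cmR ρ c b (F.prod G) ε < cmM ρ c b (F.prod G) ε t) :
    ∃ θ, IsCMSlope ρ c b (mix ε (F.prod G) K) θ := by
  have hε1 : ε ≤ 1 := by linarith
  obtain ⟨s₀, hs₀, h₀⟩ := exists_admissible_of_cmR_ne_top hρ hc _ hε0 hε1 hr.ne_top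
  have hmono := strictMonoOn_cmM hp hρ hc hb0 hε0 hε hF hG hs₀ h₀
  have := isProbabilityMeasure_mix (F.prod G) K hε0 hε1
  obtain ⟨s₁, hs₁, hle₁, hlt₁⟩ := scaleProfile_lt_iff.1
    ((cmProfile_mix_le_cmR hρ hc (F.prod G) K hε0 hε1).trans_lt hr)
  obtain ⟨V, α, θ, σ, hθ, hσ, hup, hmin⟩ := exists_minimizing_triple hρ hc hb0 hε hF G
    (Θ := Metric.closedBall 0 t) Metric.isClosed_closedBall
    (fun θ hθ => mem_closedBall_zero_iff.1 hθ) (e := meanLoss ρ (mix ε (F.prod G) K))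
    (fun α θ s => by
      rw [meanLoss_mix hρ _ _ hε0 hε1]
      exact le_add_of_nonneg_right (mul_nonneg hε0 (meanLoss_nonneg hρ K α θ s)))
    (fun a s q t α σ σ' Q θ ha ht hs hσ hσ' hle hq =>
      meanLoss_le_of_tendsto hρ _ ha ht hs hσ hσ' hle hq)
    ⟨0, 0, Metric.mem_closedBall_self ht, s₁, hs₁, hle₁⟩
  have hV : ∀ α' θ', (V : EReal) ≤ cmProfile ρ c b (mix ε (F.prod G) K) α' θ' := by
    intro α' θ'
    by_cases hθ' : ‖θ'‖ ≤ t
    · exact le_scaleProfile_iff.2 fun s hs hle => EReal.coe_le_coe_iff.2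
        (hmin α' θ' (mem_closedBall_zero_iff.2 hθ') s hs hle)
    · push Not at hθ'
      refine le_trans ?_ (cmM_le_cmProfile_mix hρ hc _ K hε0 hε1 α' θ')
      refine le_trans ?_ (hmono ht (ht.trans hθ'.le) hθ').le
      exact (EReal.coe_le_coe_iff.2 (hmin 0 0 (Metric.mem_closedBall_self ht) s₁ hs₁ hle₁)).trans
        hlt₁.le
  have hle : cmProfile ρ c b (mix ε (F.prod G) K) α θ ≤ V := by
    have := scaleProfile_le_of_forall_gt (c := c) hσ (fun s hs => (hup s hs).1)
      (fun s hs => (hup s hs).2)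
    rwa [sub_add_cancel] at this
  exact ⟨θ, α, V, le_antisymm hle (hV α θ), fun α' θ' => hle.trans (hV α' θ')⟩

/-! ### Bounds for the maximum bias -/

lemma incInverse_eq_top {m : ℝ → EReal} {r : EReal} (h : ∀ t, 0 ≤ t → m t ≤ r) :
    incInverse m r = ⊤ := by
  refine ENNReal.eq_top_of_forall_nnreal_le fun x => ?_
  refine le_iSup_of_le (x : ℝ) (le_iSup_of_le x.2 (le_iSup_of_le (h x x.2) ?_))
  rw [ENNReal.ofReal_coe_nnreal]

lemma ofReal_le_incInverse {m : ℝ → EReal} {r : EReal} {t : ℝ} (ht : 0 ≤ t) (h : m t ≤ r) :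
    ENNReal.ofReal t ≤ incInverse m r :=
  le_iSup_of_le t (le_iSup_of_le ht (le_iSup_of_le h le_rfl))

lemma exists_of_lt_incInverse {m : ℝ → EReal} {r : EReal} {x : ENNReal}
    (h : x < incInverse m r) : ∃ t, 0 ≤ t ∧ m t ≤ r ∧ x < ENNReal.ofReal t := by
  simpa only [incInverse, lt_iSup_iff, exists_prop] using h

lemma maxBias_le (hp : 0 < p) (hρ : IsLoss ρ) {c b ε : ℝ} (hc : 0 < c) (hb0 : 0 < b)
    (hε0 : 0 ≤ ε) (hε1 : ε ≤ 1) {F : Measure ℝ} [IsProbabilityMeasure F] (hF : IsErrorLaw F)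
    {G : Measure (Regr p)} [IsProbabilityMeasure G] (hG : IsRegressorLaw G)
    {T : ProbabilityMeasure (ℝ × Regr p) → Option (Regr p)} (hT : IsCMEstimate ρ c b T) :
    maxBias T (F.prod G) ε
      ≤ incInverse (cmM ρ c b (F.prod G) ε) (cmR ρ c b (F.prod G) ε) := by
  refine iSup_le fun K => iSup_le fun hK => ?_
  obtain ⟨K', hK'⟩ := hK
  cases hTK : T K with
  | some θ =>
    obtain ⟨α, v, -, hmin⟩ := (hT K).1 θ hTK
    rw [hK'] at hmin
    exact ofReal_le_incInverse (norm_nonneg θ) ((cmM_le_cmProfile_mix hρ hc _ _ hε0 hε1 α θ).trans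
      ((hmin 0 0).trans (cmProfile_mix_le_cmR hρ hc _ _ hε0 hε1)))
  | none =>
    refine (incInverse_eq_top fun t ht => ?_).ge.trans' le_top
    by_contra! hlt
    rcases lt_or_ge ε (1 - b) with hε | hε
    · obtain ⟨θ, hθ⟩ := exists_isCMSlope hp hρ hc hb0 hε0 hε hF hG
        (K' : Measure (ℝ × Regr p)) ht hlt
      rw [← hK'] at hθ
      exact (hT K).2 hTK θ hθ
    · rw [cmM_eq_bot hp hρ hc _ hε0 hε1 hε ht] at hlt
      exact not_lt_bot hlt

lemma exists_mem_neighborhood {ε : ℝ} (hε0 : 0 ≤ ε) (hε1 : ε ≤ 1) (H K : Measure (ℝ × Regr p))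
    [IsProbabilityMeasure H] [hK : IsProbabilityMeasure K] :
    ∃ M ∈ neighborhood H ε, (M : Measure (ℝ × Regr p)) = mix ε H K :=
  ⟨⟨mix ε H K, isProbabilityMeasure_mix H K hε0 hε1⟩, ⟨⟨K, hK⟩, rfl⟩, rfl⟩

lemma bias_le_maxBias {ε : ℝ} {H : Measure (ℝ × Regr p)}
    (T : ProbabilityMeasure (ℝ × Regr p) → Option (Regr p))
    {M : ProbabilityMeasure (ℝ × Regr p)} (hM : M ∈ neighborhood H ε) :
    bias (T M) ≤ maxBias T H ε :=
  le_iSup_of_le M (le_iSup_of_le hM le_rfl)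

lemma maxBias_eq_top {c b ε : ℝ} (hε0 : 0 ≤ ε) (hε1 : ε ≤ 1) (H K : Measure (ℝ × Regr p))
    [IsProbabilityMeasure H] [IsProbabilityMeasure K]
    {T : ProbabilityMeasure (ℝ × Regr p) → Option (Regr p)} (hT : IsCMEstimate ρ c b T)
    (hno : ∀ θ, ¬ IsCMSlope ρ c b (mix ε H K) θ) : maxBias T H ε = ⊤ := by
  obtain ⟨M, hM, hMeq⟩ := exists_mem_neighborhood hε0 hε1 H K
  have hbias := bias_le_maxBias T hM
  rw [← hMeq] at hno
  have hnone : T M = none :=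
    Option.eq_none_iff_forall_ne_some.2 fun θ hθ => hno θ ((hT M).1 θ hθ)
  rw [hnone] at hbias
  exact top_le_iff.1 hbias

/-- A point mass at the origin has zero residual at the centre. The central part costs at most `1 -
ε ≤ b`, so every scale is admissible, the objective has infimum `-∞`, and no solution exists. -/
lemma maxBias_eq_top_of_le (hρ : IsLoss ρ) {c b ε : ℝ} (hc : 0 < c) (hε0 : 0 ≤ ε) (hε1 : ε ≤ 1)
    (hε : 1 - b ≤ ε) (H : Measure (ℝ × Regr p)) [IsProbabilityMeasure H]
    {T : ProbabilityMeasure (ℝ × Regr p) → Option (Regr p)} (hT : IsCMEstimate ρ c b T) :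
    maxBias T H ε = ⊤ := by
  refine maxBias_eq_top hε0 hε1 H (Measure.dirac 0) hT fun θ hθ => ?_
  obtain ⟨α, v, hv, hmin⟩ := hθ
  have hbot : cmProfile ρ c b (mix ε H (Measure.dirac 0)) 0 0 = ⊥ := by
    rw [cmProfile_mix hρ c b _ _ hε0 hε1]
    refine scaleProfile_eq_bot hc fun s hs => ?_
    rw [meanLoss_dirac]
    have := mul_le_mul_of_nonneg_left (meanLoss_le_one hρ H 0 0 s) (by linarith : 0 ≤ 1 - ε)
    simp only [Prod.fst_zero, Prod.snd_zero, inner_zero_left, sub_zero, zero_div, hρ.map_zero,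
      mul_zero, add_zero]
    linarith
  have := hmin 0 0
  rw [hbot, hv] at this
  exact EReal.coe_ne_bot v (le_bot_iff.1 this)

/-- Point masses at remote points of the hyperplane of `(α, θ)` with `‖θ‖ = t` force the slopes
of the solutions to have norm at least `t` in the limit. -/
lemma ofReal_le_maxBias_of_lt (hρ : IsLoss ρ) {c b ε : ℝ} (hc : 0 < c) (hb0 : 0 < b)
    (hε0 : 0 ≤ ε) (hε : ε < 1 - b) {F : Measure ℝ} [IsProbabilityMeasure F] (hF : IsErrorLaw F)
    (G : Measure (Regr p)) [IsProbabilityMeasure G]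
    {T : ProbabilityMeasure (ℝ × Regr p) → Option (Regr p)} (hT : IsCMEstimate ρ c b T) {t : ℝ}
    (hr : cmM ρ c b (F.prod G) ε t < cmR ρ c b (F.prod G) ε) :
    ENNReal.ofReal t ≤ maxBias T (F.prod G) ε := by
  have hε1 : ε ≤ 1 := by linarith
  have hpos : 0 < 1 - ε := by linarith
  by_contra! hlt
  have hne : maxBias T (F.prod G) ε ≠ ⊤ := hlt.ne_top
  set t' := (maxBias T (F.prod G) ε).toReal with ht'
  have ht't : t' < t := by
    rw [← ENNReal.ofReal_toReal hne] at hlt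
    exact ((ENNReal.ofReal_lt_ofReal_iff' ).1 hlt).1
  have ht0 : 0 < t := ENNReal.toReal_nonneg.trans_lt ht't
  obtain ⟨q, hq1, hq2⟩ := EReal.lt_iff_exists_real_btwn.1 hr
  obtain ⟨α, θ, s, hθ, hs, hle, hval⟩ : ∃ (α : ℝ) (θ : Regr p) (s : ℝ), ‖θ‖ = t ∧ 0 < s ∧
      (1 - ε) * meanLoss ρ (F.prod G) α θ s ≤ b ∧
      ((c * ((1 - ε) * meanLoss ρ (F.prod G) α θ s) + Real.log s : ℝ) : EReal) < q := by
    by_contra! hcon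
    exact absurd ((le_cmM_iff hρ hc _ hε0 hε1).2 hcon) (not_le.2 hq1)
  set e : Regr p := t⁻¹ • θ with he
  have he1 : ‖e‖ = 1 := by
    rw [he, norm_smul, hθ, Real.norm_of_nonneg (inv_nonneg.2 ht0.le), inv_mul_cancel₀ ht0.ne']
  have heθ : inner ℝ e θ = t := by
    rw [he, real_inner_smul_left, real_inner_self_eq_norm_sq, hθ]
    field_simp
  -- Since `e'θ = t`, these points lie on the hyperplane `y = α + x'θ`, and they move off in the
  -- direction that best distinguishes `θ` from shorter slopes.
  let z : ℕ → ℝ × Regr p := fun n => (α + n * t, (n : ℝ) • e)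
  have hslope : ∀ n, ∃ θ', ‖θ'‖ ≤ t' ∧
      IsCMSlope ρ c b (mix ε (F.prod G) (Measure.dirac (z n))) θ' := by
    intro n
    obtain ⟨M, hM, hMeq⟩ := exists_mem_neighborhood hε0 hε1 (F.prod G) (Measure.dirac (z n))
    have hb := bias_le_maxBias T hM
    cases hTM : T M with
    | none =>
      rw [hTM] at hb
      exact absurd (top_le_iff.1 hb) hne
    | some θ' =>
      rw [hTM] at hb
      have hslope := (hT M).1 θ' hTM
      rw [hMeq] at hslope
      exact ⟨θ', (ENNReal.ofReal_le_iff_le_toReal hne).1 hb, hslope⟩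
  have htriple : ∀ n, ∃ (a : ℝ) (θ' : Regr p) (u : ℝ), ‖θ'‖ ≤ t' ∧ 0 < u ∧
      (1 - ε) * meanLoss ρ (F.prod G) a θ' u
        + ε * ρ (((z n).1 - a - inner ℝ (z n).2 θ') / u) ≤ b ∧
      c * ((1 - ε) * meanLoss ρ (F.prod G) a θ' u
        + ε * ρ (((z n).1 - a - inner ℝ (z n).2 θ') / u)) + Real.log u ≤ q := by
    intro n
    obtain ⟨θ', hθ', a, v, -, hmin⟩ := hslope n
    have h1 : cmProfile ρ c b (mix ε (F.prod G) (Measure.dirac (z n))) α θ < q := by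
      rw [cmProfile_mix hρ c b _ _ hε0 hε1]
      refine scaleProfile_lt_iff.2 ⟨s, hs, ?_⟩
      have hres : (z n).1 - α - inner ℝ (z n).2 θ = 0 := by
        simp only [z, real_inner_smul_left, heθ]
        ring
      rw [meanLoss_dirac, hres, zero_div, hρ.map_zero, mul_zero, add_zero]
      exact ⟨hle, hval⟩
    have h2 := (hmin α θ).trans_lt h1
    rw [cmProfile_mix hρ c b _ _ hε0 hε1] at h2
    obtain ⟨u, hu, hub, huq⟩ := scaleProfile_lt_iff.1 h2
    rw [meanLoss_dirac] at hub huq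
    exact ⟨a, θ', u, hθ', hu, hub, (EReal.coe_lt_coe_iff.1 huq).le⟩
  choose a θ' u hθ' hu hub huq using htriple
  have hcontam : ∀ n, 0 ≤ ε * ρ (((z n).1 - a n - inner ℝ (z n).2 (θ' n)) / u n) := fun n =>
    mul_nonneg hε0 (hρ.nonneg _)
  have hcentral : ∀ n, 0 ≤ (1 - ε) * meanLoss ρ (F.prod G) (a n) (θ' n) (u n) := fun n =>
    mul_nonneg hpos.le (meanLoss_nonneg hρ _ _ _ _)
  have hule : ∀ n, u n ≤ Real.exp q := fun n => by
    rw [← Real.log_le_iff_le_exp (hu n)]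
    have := mul_nonneg hc.le (add_nonneg (hcentral n) (hcontam n))
    linarith [huq n]
  obtain ⟨α', θ'', σ, φ, hσ, hφ, hα', hθ'', hσl⟩ := exists_subseq_tendsto hρ hF G
    (div_one_sub_lt_one hε hb0) hθ' hu hule
    (fun n => le_div_of_one_sub_mul_le hε hb0 (by linarith [hub n, hcontam n]))
  have hml := (tendsto_meanLoss hρ hF G hα' hθ'' hσl hσ).const_mul (1 - ε)
  have hρ1 : Tendsto (fun n => ρ (((z (φ n)).1 - a (φ n) - inner ℝ (z (φ n)).2 (θ' (φ n)))
      / u (φ n))) atTop (𝓝 1) := by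
    refine hρ.tendsto_one_of_abs ?_
    -- A slope of norm at most `t'` leaves a residual of at least `n (t - t') + α - a`, while the
    -- intercepts and scales converge.
    have hdiv : Tendsto (fun n => ((φ n : ℝ) * (t - t') + (α - a (φ n))) * (u (φ n))⁻¹) atTop
        atTop := by
      refine Tendsto.atTop_mul_pos (inv_pos.2 hσ) ?_ (hσl.inv₀ hσ.ne')
      refine Tendsto.atTop_add ?_ (tendsto_const_nhds.sub hα')
      exact (tendsto_natCast_atTop_atTop.comp hφ.tendsto_atTop).atTop_mul_const (sub_pos.2 ht't)
    refine tendsto_atTop_mono (fun n => ?_) hdiv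
    refine le_trans ?_ (le_abs_self _)
    rw [div_eq_mul_inv]
    refine mul_le_mul_of_nonneg_right ?_ (inv_nonneg.2 (hu _).le)
    have h1 : inner ℝ e (θ' (φ n)) ≤ t' :=
      (real_inner_le_norm _ _).trans (by rw [he1, one_mul]; exact hθ' _)
    have h2 := mul_le_mul_of_nonneg_left h1 (Nat.cast_nonneg (α := ℝ) (φ n))
    simp only [z, real_inner_smul_left]
    linarith
  have hlim := hml.add (hρ1.const_mul ε)
  rw [mul_one] at hlim
  have hb' := le_of_tendsto' hlim fun n => hub _
  have hq' := le_of_tendsto' ((hlim.const_mul c).add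
    ((Real.continuousAt_log hσ.ne').tendsto.comp hσl)) fun n => huq _
  -- Moving the limiting fit to the centre lowers the central loss, so `σ` is admissible in the
  -- definition of `r` with value at most `q`.
  have h00 := mul_le_mul_of_nonneg_left (meanLoss_zero_le hρ hF G α' θ'' σ) hpos.le
  have hfin : cmR ρ c b (F.prod G) ε ≤ q := by
    rw [cmR_eq hρ hc _ hε0 hε1]
    refine (scaleProfile_le hσ (by linarith)).trans (EReal.coe_le_coe_iff.2 (le_trans ?_ hq'))
    gcongr
  exact absurd hq2 (not_lt.2 hfin)

lemma le_maxBias (hp : 0 < p) (hρ : IsLoss ρ) {c b ε : ℝ} (hc : 0 < c) (hb0 : 0 < b)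
    (hε0 : 0 ≤ ε) (hε1 : ε ≤ 1) {F : Measure ℝ} [IsProbabilityMeasure F] (hF : IsErrorLaw F)
    {G : Measure (Regr p)} [IsProbabilityMeasure G] (hG : IsRegressorLaw G)
    {T : ProbabilityMeasure (ℝ × Regr p) → Option (Regr p)} (hT : IsCMEstimate ρ c b T) :
    incInverse (cmM ρ c b (F.prod G) ε) (cmR ρ c b (F.prod G) ε)
      ≤ maxBias T (F.prod G) ε := by
  rcases le_or_gt (1 - b) ε with hε | hε
  · rw [maxBias_eq_top_of_le hρ hc hε0 hε1 hε _ hT]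
    exact le_top
  by_cases hadm : ∃ (α : ℝ) (θ : Regr p) (s : ℝ), 0 < s ∧
      (1 - ε) * meanLoss ρ (F.prod G) α θ s ≤ b
  · obtain ⟨α₀, θ₀, s₀, hs₀, h₀⟩ := hadm
    have hmono := strictMonoOn_cmM hp hρ hc hb0 hε0 hε hF hG hs₀ h₀
    refine iSup_le fun t => iSup_le fun ht => iSup_le fun hle => ?_
    -- Any norm `y < t` satisfies `m(y) < m(t) ≤ r` strictly, as the point mass construction
    -- requires.
    refine le_of_forall_lt fun x hx => ?_
    obtain ⟨y, hxy, hyt⟩ := exists_between hx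
    have hy : y ≠ ⊤ := hyt.ne_top
    rw [← ENNReal.ofReal_toReal hy] at hxy hyt
    have hlt := (ENNReal.ofReal_lt_ofReal_iff'.1 hyt).1
    exact hxy.trans_le (ofReal_le_maxBias_of_lt hρ hc hb0 hε0 hε hF G hT
      ((hmono ENNReal.toReal_nonneg ht hlt).trans_le hle))
  -- If the constraint can never be met, every profile is `⊤`, and the estimate is undefined.
  · push Not at hadm
    rw [maxBias_eq_top hε0 hε1 (F.prod G) (Measure.dirac 0) hT]
    · exact le_top
    · rintro θ ⟨α, v, hv, -⟩
      have htop := cmM_le_cmProfile_mix (c := c) (b := b) hρ hc (F.prod G) (Measure.dirac 0)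
        hε0 hε1 α θ
      rw [hv, ← not_lt] at htop
      refine htop ((EReal.coe_lt_top v).trans_le ?_)
      exact (le_cmM_iff hρ hc _ hε0 hε1).2 fun α' θ' s _ hs hle =>
        absurd hle (not_le.2 (hadm α' θ' s hs))

lemma incInverse_cmM_eq_iff (hp : 0 < p) (hρ : IsLoss ρ) {c b ε : ℝ} (hc : 0 < c) (hb0 : 0 < b)
    (hε0 : 0 ≤ ε) (hε : ε < 1 - b) {F : Measure ℝ} [IsProbabilityMeasure F] (hF : IsErrorLaw F)
    {G : Measure (Regr p)} [IsProbabilityMeasure G] (hG : IsRegressorLaw G)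
    (hr : cmR ρ c b (F.prod G) ε ≠ ⊤) {t : ℝ} (ht : 0 ≤ t) :
    incInverse (cmM ρ c b (F.prod G) ε) (cmR ρ c b (F.prod G) ε) = ENNReal.ofReal t ↔
      cmM ρ c b (F.prod G) ε t = cmR ρ c b (F.prod G) ε := by
  have hε1 : ε ≤ 1 := by linarith
  obtain ⟨s₀, hs₀, h₀⟩ := exists_admissible_of_cmR_ne_top hρ hc _ hε0 hε1 hr
  have hmono := strictMonoOn_cmM hp hρ hc hb0 hε0 hε hF hG hs₀ h₀
  have hM0 := cmM_zero_le_cmR (b := b) hρ hc (F.prod G) hε0 hε1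
  constructor
  · intro heq
    -- `r` is not `-∞`, since it dominates `m(0)`, a real number because it is attained.
    obtain ⟨r, hreal⟩ : ∃ r : ℝ, cmR ρ c b (F.prod G) ε = r := by
      obtain ⟨α, θ, σ, -, -, -, h⟩ := exists_cmM_eq hp hρ hc hb0 hε0 hε hF G hs₀ h₀ le_rfl
      refine ⟨_, (EReal.coe_toReal hr fun hbot => ?_).symm⟩
      rw [hbot, h] at hM0
      exact EReal.coe_ne_bot _ (le_bot_iff.1 hM0)
    rcases lt_trichotomy (cmM ρ c b (F.prod G) ε t) (cmR ρ c b (F.prod G) ε) with h | h | h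
    · exfalso
      rw [hreal] at h
      obtain ⟨t', htt', hle⟩ := exists_gt_cmM_le hp hρ hc hb0 hε0 hε hF G hs₀ h₀ ht h
      rw [← hreal] at hle
      have := ofReal_le_incInverse (ht.trans htt'.le) hle
      rw [heq] at this
      exact absurd ((ENNReal.ofReal_lt_ofReal_iff (ht.trans_lt htt')).2 htt') (not_lt.2 this)
    · exact h
    · exfalso
      rcases ht.eq_or_lt with h0 | h0
      · rw [← h0] at h
        exact absurd h (not_lt.2 hM0)
      · refine absurd h (not_lt.2 ?_)
        rw [hreal]
        refine cmM_le_of_forall_lt hp hρ hc hb0 hε0 hε hF G hs₀ h₀ h0 fun t' ht'0 ht't => ?_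
        have hlt : ENNReal.ofReal t' < incInverse (cmM ρ c b (F.prod G) ε)
            (cmR ρ c b (F.prod G) ε) := by
          rw [heq]
          exact (ENNReal.ofReal_lt_ofReal_iff h0).2 ht't
        obtain ⟨t'', ht''0, hle, hlt'⟩ := exists_of_lt_incInverse hlt
        rw [← hreal]
        exact (hmono ht'0 ht''0 (ENNReal.ofReal_lt_ofReal_iff'.1 hlt').1).le.trans hle
  · intro heq
    refine le_antisymm (iSup_le fun t' => iSup_le fun ht' => iSup_le fun hle => ?_)
      (ofReal_le_incInverse ht heq.le)
    rw [← heq] at hle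
    exact ENNReal.ofReal_le_ofReal ((hmono.le_iff_le ht' ht).1 hle)

end CMRegression

theorem theorem3p2 {p : ℕ} (hp : 0 < p)
    (ρ : ℝ → ℝ) (hρ : CMRegression.IsLoss ρ)
    (c b : ℝ) (hc : 0 < c) (hb0 : 0 < b) (hb1 : b < 1)
    (Fo : MeasureTheory.Measure ℝ) [MeasureTheory.IsProbabilityMeasure Fo]
    (hFo : CMRegression.IsErrorLaw Fo)
    (Go : MeasureTheory.Measure (CMRegression.Regr p)) [MeasureTheory.IsProbabilityMeasure Go]
    (hGo : CMRegression.IsRegressorLaw Go)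
    (T : MeasureTheory.ProbabilityMeasure (ℝ × CMRegression.Regr p) →
      Option (CMRegression.Regr p))
    (hT : CMRegression.IsCMEstimate ρ c b T)
    (ε : ℝ) (hε0 : 0 ≤ ε) (hε1 : ε ≤ 1) :
    -- the maximum bias is `m⁻¹(r)`
    CMRegression.maxBias T (Fo.prod Go) ε =
      CMRegression.incInverse (CMRegression.cmM ρ c b (Fo.prod Go) ε)
        (CMRegression.cmR ρ c b (Fo.prod Go) ε) ∧
    -- below the breakdown point `m` is one-to-one, and `m⁻¹` is its inverse in the strict sense
    (ε < 1 - b → CMRegression.cmR ρ c b (Fo.prod Go) ε ≠ ⊤ →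
      StrictMonoOn (CMRegression.cmM ρ c b (Fo.prod Go) ε) (Set.Ici 0) ∧
      ∀ t : ℝ, 0 ≤ t →
        (CMRegression.maxBias T (Fo.prod Go) ε = ENNReal.ofReal t ↔
          CMRegression.cmM ρ c b (Fo.prod Go) ε t = CMRegression.cmR ρ c b (Fo.prod Go) ε)) ∧
    -- the value `r` is finite in the usual range
    (ContinuousAt ρ 0 → ε < b → CMRegression.cmR ρ c b (Fo.prod Go) ε ≠ ⊤) := by
  have hM : CMRegression.maxBias T (Fo.prod Go) ε =
      CMRegression.incInverse (CMRegression.cmM ρ c b (Fo.prod Go) ε)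
        (CMRegression.cmR ρ c b (Fo.prod Go) ε) :=
    le_antisymm (CMRegression.maxBias_le hp hρ hc hb0 hε0 hε1 hFo hGo hT)
      (CMRegression.le_maxBias hp hρ hc hb0 hε0 hε1 hFo hGo hT)
  refine ⟨hM, fun hε hr => ⟨?_, fun t ht => ?_⟩,
    fun h0 hε => CMRegression.cmR_ne_top hρ hc hε0 hε1 hFo Go h0 hε⟩
  · obtain ⟨s, hs, hle⟩ := CMRegression.exists_admissible_of_cmR_ne_top hρ hc _ hε0 hε1 hr
    exact CMRegression.strictMonoOn_cmM hp hρ hc hb0 hε0 hε hFo hGo hs hle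
  · rw [hM]
    exact CMRegression.incInverse_cmM_eq_iff hp hρ hc hb0 hε0 hε hFo hGo hr ht
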